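/- Let $f=(f_1,\dots,f_n)$ with $f_i\in\mathbb R[x,u]$, $x\in\mathbb R^n$, $u\in\mathbb R^m$, and let $X=\{x\in\mathbb R^n: g_{X,i}(x)\ge 0,\ i=1,\dots,n_X\}$ and $U=\{u\in\mathbb R^m: g_{U,i}(u)\ge 0,\ i=1,\dots,n_U\}$ with polynomials $g_{X,i}\in\mathbb R[x]$, $g_{U,i}\in\mathbb R[u]$, where one of the $g_{X,i}$ is $R_X^2-\|x\|_2^2$ and one of the $g_{U,i}$ is $R_U^2-\|u\|_2^2$ for real constants $R_X,R_U$. Let $\lambda$ be Lebesgue measure on $\mathbb R^n$. Fix a discount factor, $\alpha\in(0,1)$ in discrete time and $\beta>0$ in continuous time, and put $$\mathcal A v(x,u)=v(x)-\alpha v(f(x,u))\ \text{(discrete time)},\qquad \mathcal A v(x,u)=\beta v(x)-\operatorname{grad} v(x)\cdot f(x,u)\ \text{(continuous time)}.$$ Let $\mathcal V$ be $C(\mathbb R^n)$ in discrete time and $C^1(\mathbb R^n)$ in continuous time. Infinite-dimensional LPs. Let $p^*$ be the supremum of $\mu_0(X)$ over finite nonnegative Borel measures $\mu$ supported in $X\times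 U$ and $\mu_0,\hat\mu_0$ supported in $X$ such that $\int\mathcal A v\,d\mu=\int v\,d\mu_0$ for all $v\in\mathcal V$ and $\int w\,d\mu_0+\int w\,d\hat\mu_0=\int_X w\,d\lambda$ for all $w\in C(X)$. Let $d^*$ be the infimum of $\int_X w\,d\lambda$ over $v\in\mathcal V$, $w\in C(X)$ with $\mathcal A v\ge 0$ on $X\times U$, and $w\ge v+1$ and $w\ge 0$ on $X$. Finite-dimensional problems. Let $r_1\le r_2\le\cdots$ be integers with $r_k\ge k$ (for instance $r_k=k$, or $r_k$ so large that $\deg\mathcal A v\le 2r_k$ whenever $\deg v\le 2k$). For $k\ge1$ let $p_k^*$ be the supremum of $(y_0)_0$ over real sequences $y$ (indexed by the monomials in $(x,u)$ of degree $\le 2r_k$) and $y_0,\hat y_0$ (indexed by the monomials in $x$ of degree $\le 2k$) such that, with $L_y(\sum_a p_a z^a)=\sum_a p_a y_a$, * $L_y(\mathcal A v)=L_{y_0}(v)$ for all polynomials $v\in\mathbb R[x]$ with $\deg v\le 2k$ and $\deg\mathcal A v\le 2r_k$; * $L_{y_0}(w)+L_{\hat y_0}(w)=\int_X w\,d\lambda$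 for all polynomials $w\in\mathbb R[x]$ with $\deg w\le 2k$; * the moment matrix of order $r_k$ of $y$ and those of order $k$ of $y_0,\hat y_0$ are positive semidefinite, as are the localizing matrices of order $r_k-\lceil\deg g/2\rceil$ of $y$ for $g=g_{X,i},g_{U,i}$ and those of order $k-\lceil\deg g/2\rceil$ of $y_0,\hat y_0$ for $g=g_{X,i}$ (no condition when the order is negative). Let $d_k^*$ be the infimum of $\int_X w\,d\lambda$ over polynomials $v,w\in\mathbb R[x]$ of degree $\le 2k$ for which there are sums of squares of polynomials $q_i,t_i\in\mathbb R[x,u]$ and $p_i,s_i\in\mathbb R[x]$ with $$\mathcal A v=q_0+\sum_{i=1}^{n_X} q_i\,g_{X,i}+\sum_{i=1}^{n_U} t_i\,g_{U,i},\qquad w-v-1=p_0+\sum_{i=1}^{n_X} p_i\,g_{X,i},\qquad w=s_0+\sum_{i=1}^{n_X} s_i\,g_{X,i},$$ every term on the right being of degree $\le 2r_k$ in the first identity and $\le 2k$ in the other two. Then, both in discrete and in continuous time, all these values are finite, the suprema $p^*$ and $p_k^*$ are attained, and for all $k\ge 1$ $$d^*\le d_{k+1}^*\le d_k^*,\qquad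 \lim_{k\to\infty}d_k^*=d^*,\qquad p^*\le p_{k+1}^*\le p_k^*,\qquad \lim_{k\to\infty}p_k^*=p^*.$$ -/

import Mathlib

open MvPolynomial MeasureTheory Filter Topology

noncomputable section

namespace MCI

/-- The basic semialgebraic set `{z | gᵢ(z) ≥ 0 for all i}`. -/
def semialgSet {σ ι : Type*} (g : ι → MvPolynomial σ ℝ) : Set (σ → ℝ) :=
  {z | ∀ i, 0 ≤ eval z (g i)}

/-- One of the polynomials `gᵢ` is `R² - ‖z‖₂²` for some real constant `R`. -/
def HasBallConstraint {σ ι : Type*} [Fintype σ] (g : ι → MvPolynomial σ ℝ) : Prop :=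
  ∃ i, ∃ R : ℝ, g i = C (R ^ 2) - ∑ j, X j ^ 2

/-- The value `f(x,u) ∈ ℝⁿ` of a polynomial vector field in the variables `(x,u)`. -/
def evalField {n m : ℕ} (f : Fin n → MvPolynomial (Fin n ⊕ Fin m) ℝ)
    (x : Fin n → ℝ) (u : Fin m → ℝ) : Fin n → ℝ :=
  fun i => eval (Sum.elim x u) (f i)

/-! ### The infinite-dimensional linear programs

A nonnegative element of `M(K)` is a finite Borel measure with support in `K`.
The functions `v` are defined on all of `ℝⁿ`, since `v(f(x,u))` is needed where `f(x,u) ∉ X`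
and `grad v` is needed on all of `X`; the functions `w` are elements of `C(X)`. -/

/-- The measures `μ₀, μ̂₀` are supported in `K` and add up to the Lebesgue measure on `K`,
tested against `C(K)`. -/
def LebesgueSplit {n : ℕ} (K : Set (Fin n → ℝ)) (μ₀ μ₀' : Measure (Fin n → ℝ)) : Prop :=
  IsFiniteMeasure μ₀ ∧ IsFiniteMeasure μ₀' ∧ μ₀.support ⊆ K ∧ μ₀'.support ⊆ K ∧
  ∀ w : (Fin n → ℝ) → ℝ, ContinuousOn w K →
    ∫ x, w x ∂μ₀ + ∫ x, w x ∂μ₀' = ∫ x in K, w x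

/-- Objective values `μ₀(X)` of the feasible points of the discrete-time primal LP. -/
def discretePrimalValues {n m : ℕ} (f : Fin n → MvPolynomial (Fin n ⊕ Fin m) ℝ)
    (K : Set (Fin n → ℝ)) (U : Set (Fin m → ℝ)) (α : ℝ) : Set ℝ :=
  {c | ∃ (μ : Measure ((Fin n → ℝ) × (Fin m → ℝ))) (μ₀ μ₀' : Measure (Fin n → ℝ)),
    IsFiniteMeasure μ ∧ μ.support ⊆ K ×ˢ U ∧ LebesgueSplit K μ₀ μ₀' ∧
    (∀ v : (Fin n → ℝ) → ℝ, Continuous v →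
      ∫ z, v z.1 ∂μ = ∫ x, v x ∂μ₀ + α * ∫ z, v (evalField f z.1 z.2) ∂μ) ∧
    c = μ₀.real K}

/-- Objective values `μ₀(X)` of the feasible points of the continuous-time primal LP. -/
def continuousPrimalValues {n m : ℕ} (f : Fin n → MvPolynomial (Fin n ⊕ Fin m) ℝ)
    (K : Set (Fin n → ℝ)) (U : Set (Fin m → ℝ)) (β : ℝ) : Set ℝ :=
  {c | ∃ (μ : Measure ((Fin n → ℝ) × (Fin m → ℝ))) (μ₀ μ₀' : Measure (Fin n → ℝ)),
    IsFiniteMeasure μ ∧ μ.support ⊆ K ×ˢ U ∧ LebesgueSplit K μ₀ μ₀' ∧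
    (∀ v : (Fin n → ℝ) → ℝ, ContDiff ℝ 1 v →
      β * ∫ z, v z.1 ∂μ = ∫ x, v x ∂μ₀ + ∫ z, fderiv ℝ v z.1 (evalField f z.1 z.2) ∂μ) ∧
    c = μ₀.real K}

/-- Objective values `∫_X w dλ` of the feasible points of the discrete-time dual LP. -/
def discreteDualValues {n m : ℕ} (f : Fin n → MvPolynomial (Fin n ⊕ Fin m) ℝ)
    (K : Set (Fin n → ℝ)) (U : Set (Fin m → ℝ)) (α : ℝ) : Set ℝ :=
  {c | ∃ v w : (Fin n → ℝ) → ℝ, Continuous v ∧ ContinuousOn w K ∧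
    (∀ x ∈ K, ∀ u ∈ U, α * v (evalField f x u) ≤ v x) ∧
    (∀ x ∈ K, v x + 1 ≤ w x) ∧ (∀ x ∈ K, 0 ≤ w x) ∧
    c = ∫ x in K, w x}

/-- Objective values `∫_X w dλ` of the feasible points of the continuous-time dual LP. -/
def continuousDualValues {n m : ℕ} (f : Fin n → MvPolynomial (Fin n ⊕ Fin m) ℝ)
    (K : Set (Fin n → ℝ)) (U : Set (Fin m → ℝ)) (β : ℝ) : Set ℝ :=
  {c | ∃ v w : (Fin n → ℝ) → ℝ, ContDiff ℝ 1 v ∧ ContinuousOn w K ∧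
    (∀ x ∈ K, ∀ u ∈ U, fderiv ℝ v x (evalField f x u) ≤ β * v x) ∧
    (∀ x ∈ K, v x + 1 ≤ w x) ∧ (∀ x ∈ K, 0 ≤ w x) ∧
    c = ∫ x in K, w x}

/-! ### Moment and localizing matrices, truncated quadratic modules -/

/-- The linear functional `p ↦ ∑ₐ pₐ yₐ` of a sequence `y` indexed by the monomials. -/
def riesz {σ : Type*} (y : (σ →₀ ℕ) → ℝ) (p : MvPolynomial σ ℝ) : ℝ :=
  ∑ a ∈ p.support, p.coeff a * y a

/-- The localizing matrix of order `k` of `g`: rows and columns are indexed by the monomials of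
degree at most `k`. -/
def localizingMatrix {σ : Type*} (k : ℕ) (g : MvPolynomial σ ℝ) (y : (σ →₀ ℕ) → ℝ) :
    Matrix {a : σ →₀ ℕ // a.degree ≤ k} {a : σ →₀ ℕ // a.degree ≤ k} ℝ :=
  Matrix.of fun a b => riesz y (monomial (a.1 + b.1) 1 * g)

/-- The moment matrix of order `k`. -/
def momentMatrix {σ : Type*} (k : ℕ) (y : (σ →₀ ℕ) → ℝ) :
    Matrix {a : σ →₀ ℕ // a.degree ≤ k} {a : σ →₀ ℕ // a.degree ≤ k} ℝ :=
  Matrix.of fun a b => y (a.1 + b.1)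

/-- `⌈deg g / 2⌉`. -/
def halfDegree {σ : Type*} (g : MvPolynomial σ ℝ) : ℕ := (g.totalDegree + 1) / 2

/-- `y` is a sequence truncated to degree `2k` (extended by zero) which satisfies
`M_k(y) ⪰ 0` and `M_{k - dᵢ}(gᵢ, y) ⪰ 0`; there is no localizing constraint for `gᵢ` while
`k < dᵢ`. -/
def IsPseudoMoment {σ ι : Type*} (g : ι → MvPolynomial σ ℝ) (k : ℕ) (y : (σ →₀ ℕ) → ℝ) : Prop :=
  (∀ a : σ →₀ ℕ, 2 * k < a.degree → y a = 0) ∧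
  (momentMatrix k y).PosSemidef ∧
  ∀ i, halfDegree (g i) ≤ k → (localizingMatrix (k - halfDegree (g i)) (g i) y).PosSemidef

/-- `p = q₀ + ∑ᵢ qᵢ gᵢ` with sums of squares `q₀, qᵢ`, all terms being of degree at most `2k`. -/
def InQuadraticModule {σ ι : Type*} [Fintype ι] (g : ι → MvPolynomial σ ℝ) (k : ℕ)
    (p : MvPolynomial σ ℝ) : Prop :=
  ∃ (q₀ : MvPolynomial σ ℝ) (q : ι → MvPolynomial σ ℝ),
    IsSumSq q₀ ∧ q₀.totalDegree ≤ 2 * k ∧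
    (∀ i, IsSumSq (q i) ∧ (q i * g i).totalDegree ≤ 2 * k) ∧
    p = q₀ + ∑ i, q i * g i

/-- The polynomials in `(x,u)` that describe `X × U`. -/
def productConstraints {n m nX nU : ℕ} (gX : Fin nX → MvPolynomial (Fin n) ℝ)
    (gU : Fin nU → MvPolynomial (Fin m) ℝ) :
    Fin nX ⊕ Fin nU → MvPolynomial (Fin n ⊕ Fin m) ℝ :=
  Sum.elim (fun i => rename Sum.inl (gX i)) (fun i => rename Sum.inr (gU i))

/-- The moments of the Lebesgue measure on `K`. -/
def lebesgueMoment {n : ℕ} (K : Set (Fin n → ℝ)) (a : Fin n →₀ ℕ) : ℝ :=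
  ∫ x in K, ∏ i, x i ^ a i

/-! ### The finite-dimensional problems

Both are written for a map `A` that sends `v(x)` to the polynomial in `(x,u)` of the dynamics
constraint. -/

/-- `v(x) - α v(f(x,u))`. -/
def discreteOp {n m : ℕ} (f : Fin n → MvPolynomial (Fin n ⊕ Fin m) ℝ) (α : ℝ)
    (v : MvPolynomial (Fin n) ℝ) : MvPolynomial (Fin n ⊕ Fin m) ℝ :=
  rename Sum.inl v - C α * bind₁ f v

/-- `β v(x) - grad v · f(x,u)`. -/
def continuousOp {n m : ℕ} (f : Fin n → MvPolynomial (Fin n ⊕ Fin m) ℝ) (β : ℝ)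
    (v : MvPolynomial (Fin n) ℝ) : MvPolynomial (Fin n ⊕ Fin m) ℝ :=
  C β * rename Sum.inl v - ∑ i, rename Sum.inl (pderiv i v) * f i

/-- Objective values `(y₀)₀` of the feasible points of the primal moment relaxation of order `k`.
The sequences `y₀, ŷ₀` are truncated to degree `2k` and `y` to degree `2r`; the linear equality
constraints are those with `v, w` of degree at most `2k` which involve only moments of `y` of
degree at most `2r`. -/
def primalRelaxationValues {n m nX nU : ℕ}
    (A : MvPolynomial (Fin n) ℝ → MvPolynomial (Fin n ⊕ Fin m) ℝ)
    (gX : Fin nX → MvPolynomial (Fin n) ℝ) (gU : Fin nU → MvPolynomial (Fin m) ℝ)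
    (k r : ℕ) : Set ℝ :=
  {c | ∃ (y : (Fin n ⊕ Fin m →₀ ℕ) → ℝ) (y₀ y₀' : (Fin n →₀ ℕ) → ℝ),
    IsPseudoMoment (productConstraints gX gU) r y ∧
    IsPseudoMoment gX k y₀ ∧ IsPseudoMoment gX k y₀' ∧
    (∀ v : MvPolynomial (Fin n) ℝ, v.totalDegree ≤ 2 * k → (A v).totalDegree ≤ 2 * r →
      riesz y (A v) = riesz y₀ v) ∧
    (∀ w : MvPolynomial (Fin n) ℝ, w.totalDegree ≤ 2 * k →
      riesz y₀ w + riesz y₀' w = riesz (lebesgueMoment (semialgSet gX)) w) ∧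
    c = y₀ 0}

/-- Objective values `w'l` of the feasible points of the dual SOS approximation of order `k`:
`v, w` and the terms of the certificates on `X` are of degree at most `2k`, the terms of the
certificate on `X × U` of degree at most `2r`. -/
def dualApproximationValues {n m nX nU : ℕ}
    (A : MvPolynomial (Fin n) ℝ → MvPolynomial (Fin n ⊕ Fin m) ℝ)
    (gX : Fin nX → MvPolynomial (Fin n) ℝ) (gU : Fin nU → MvPolynomial (Fin m) ℝ)
    (k r : ℕ) : Set ℝ :=
  {c | ∃ v w : MvPolynomial (Fin n) ℝ, v.totalDegree ≤ 2 * k ∧ w.totalDegree ≤ 2 * k ∧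
    InQuadraticModule (productConstraints gX gU) r (A v) ∧
    InQuadraticModule gX k (w - v - 1) ∧
    InQuadraticModule gX k w ∧
    c = riesz (lebesgueMoment (semialgSet gX)) w}

/-- The infima of the sets `D k`, `k ≥ 1`, decrease to the infimum of `D∞`, and the maxima of the
sets `P k`, `k ≥ 1`, decrease to the maximum of `P∞`; all these infima exist in `ℝ` and all these
maxima are attained. -/
def ValuesConverge (Dinf : Set ℝ) (D : ℕ → Set ℝ) (Pinf : Set ℝ) (P : ℕ → Set ℝ) : Prop :=
  (∃ (dstar : ℝ) (d : ℕ → ℝ), IsGLB Dinf dstar ∧ (∀ k, 1 ≤ k → IsGLB (D k) (d k)) ∧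
    (∀ k, 1 ≤ k → dstar ≤ d (k + 1) ∧ d (k + 1) ≤ d k) ∧
    Tendsto d atTop (𝓝 dstar)) ∧
  (∃ (pstar : ℝ) (p : ℕ → ℝ), IsGreatest Pinf pstar ∧ (∀ k, 1 ≤ k → IsGreatest (P k) (p k)) ∧
    (∀ k, 1 ≤ k → pstar ≤ p (k + 1) ∧ p (k + 1) ≤ p k) ∧
    Tendsto p atTop (𝓝 pstar))

end MCI

end

/-! All limits come from one duality argument on the space of all polynomials. Let `d` be the
infimum of `∫ w` over polynomial pairs `(v, w)` with certificates of arbitrary degree, that is, over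
the union of the feasible sets of all orders; the nested sets give `d_k ↓ d`. The ball constraints
make the quadratic modules Archimedean, and `A 1` is a positive constant, so constants `v, w`
produce triples `(A v, w - v, w)` dominating any given triple. M. Riesz extension then yields
functionals `L, L₀, L₀'` that are nonnegative on the quadratic modules, satisfy the linear
constraints on all polynomials and have `L₀ 1 = d` (`exists_feasible_functionals`).

These functionals are used twice. Truncated, they are feasible for every relaxation, so `d ≤ p_k ≤
d_k` by weak duality at order `k`; strong duality at a fixed order is not needed. By Putinar's
theorem (`BoundsCoordinates.exists_measure`) they are integrals against measures on `X × U` and `X`,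
and density of polynomials in `C`, respectively `C¹`, extends the constraints to all test functions.
So `d` is a value of the primal LP; weak duality and the feasibility of polynomial certificates in
the dual LP force `d = p* = d*`, with `p*` attained. Feasible `v, w` of the dual LP never have to be
approximated.

Putinar's theorem rests on the Archimedean Positivstellensatz: a state minimising `p` may be taken
extreme, extreme states are multiplicative, and characters of a polynomial ring are point
evaluations. Attainment of `p_k` is compactness: the ball constraints bound all pseudo-moments by
the mass. -/

noncomputable section

namespace MCI

/-! ### Positive linear functionals on archimedean quadratic modules -/

/-- M. Riesz extension of a positive functional along a linear map. -/
theorem exists_nonneg_extension {D E : Type*} [AddCommGroup D] [Module ℝ D] [AddCommGroup E]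
    [Module ℝ E] (s : PointedCone ℝ E) (φ : D →ₗ[ℝ] E) (f : D →ₗ[ℝ] ℝ)
    (nonneg : ∀ d, φ d ∈ s → 0 ≤ f d) (dense : ∀ e, ∃ d, φ d + e ∈ s) :
    ∃ g : E →ₗ[ℝ] ℝ, (∀ d, g (φ d) = f d) ∧ ∀ e ∈ s, 0 ≤ g e := by
  -- Passing to `D × E` avoids assuming `φ` injective: `f` lives on the first factor, and the
  -- pulled-back cone identifies `d` with `φ d`.
  let s' : PointedCone ℝ (D × E) := s.comap (φ.coprod LinearMap.id)
  have hs' : ∀ d e, (d, e) ∈ s' ↔ φ d + e ∈ s := fun d e => by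
    simp [s', PointedCone.mem_comap]
  let F : (D × E) →ₗ.[ℝ] ℝ :=
    ⟨LinearMap.range (LinearMap.inl ℝ D E),
      (f.comp (LinearMap.fst ℝ D E)).domRestrict _⟩
  have hF : ∀ d (h : (d, (0 : E)) ∈ F.domain), F ⟨(d, 0), h⟩ = f d := fun d h => rfl
  have hdom : ∀ d, (d, (0 : E)) ∈ F.domain := fun d => ⟨d, rfl⟩
  obtain ⟨g, hg, hpos⟩ := riesz_extension s' F
    (by
      rintro ⟨x, d, rfl⟩ hx
      exact nonneg d (by simpa using (hs' d 0).1 hx))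
    (by
      rintro ⟨d, e⟩
      obtain ⟨d', hd'⟩ := dense e
      refine ⟨⟨(d' - d, 0), hdom _⟩, ?_⟩
      simpa [hs'] using hd')
  have hg' : ∀ d, g (d, 0) = f d := fun d => hg ⟨(d, 0), hdom d⟩
  refine ⟨g.comp (LinearMap.inr ℝ D E), fun d => ?_, fun e he => ?_⟩
  -- Both `(d, -φ d)` and its negative are sent to `0`, hence lie in the cone; so `g` vanishes
  -- there.
  · have h1 : 0 ≤ g (d, -φ d) := hpos _ ((hs' _ _).2 (by simp))
    have h2 : 0 ≤ g (-d, φ d) := hpos _ ((hs' _ _).2 (by simp))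
    have e1 : (d, -φ d) = (d, (0 : E)) - (0, φ d) := by simp
    have e2 : (-d, φ d) = (0, φ d) - (d, (0 : E)) := by simp
    rw [e1, map_sub, hg'] at h1
    rw [e2, map_sub, hg'] at h2
    simp only [LinearMap.comp_apply, LinearMap.inr_apply]
    linarith
  · exact hpos _ ((hs' _ _).2 (by simpa using he))

section Archimedean

variable {A : Type*} [CommRing A] [Algebra ℝ A]

/-- `M` is a quadratic module of the real algebra `A` in which every element is bounded by a
constant. -/
structure IsArchimedean (M : PointedCone ℝ A) : Prop where
  one_mem : (1 : A) ∈ M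
  mul_self_mul_mem : ∀ a : A, ∀ m ∈ M, a * a * m ∈ M
  exists_bound : ∀ a : A, ∃ N : ℝ, algebraMap ℝ A N - a ∈ M

/-- A functional that is nonnegative on squares and bounded on the powers of `g * g` satisfies
`Λ (g * g) ≤ Λ 1`. -/
theorem map_mul_self_le_of_bounded_powers (Λ : A →ₗ[ℝ] ℝ) (hΛ : ∀ a, 0 ≤ Λ (a * a)) (g : A)
    (B : ℝ) (hB : ∀ k : ℕ, Λ (g ^ k * g ^ k) ≤ B) : Λ (g * g) ≤ Λ 1 := by
  by_contra! h
  set s : ℕ → ℝ := fun k => Λ (g ^ k * g ^ k) with hs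
  -- Positivity at the square of `g ^ k - g ^ (k + 2)` makes `s` convex. With `s 1 > s 0` it would
  -- grow at least linearly, against the bound `B`.
  have hconv : ∀ k, s (k + 1) - s k ≤ s (k + 2) - s (k + 1) := by
    intro k
    have h1 := hΛ (g ^ k - g ^ (k + 2))
    have h2 : (g ^ k - g ^ (k + 2)) * (g ^ k - g ^ (k + 2)) =
        g ^ k * g ^ k - (2 : ℝ) • (g ^ (k + 1) * g ^ (k + 1)) + g ^ (k + 2) * g ^ (k + 2) := by
      rw [two_smul]; ring
    rw [h2, map_add, map_sub, map_smul, smul_eq_mul] at h1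
    simp only [hs]
    linarith
  have hstep : ∀ k, s 1 - s 0 ≤ s (k + 1) - s k := by
    intro k
    induction k with
    | zero => simp
    | succ k ih => exact ih.trans (hconv k)
  have hlin : ∀ k : ℕ, s 0 + k * (s 1 - s 0) ≤ s k := by
    intro k
    induction k with
    | zero => simp
    | succ k ih => push_cast; linarith [hstep k]
  have hδ : 0 < s 1 - s 0 := by simpa [hs] using h
  obtain ⟨k, hk⟩ := exists_nat_gt ((B - s 0) / (s 1 - s 0))
  rw [div_lt_iff₀ hδ] at hk
  linarith [hlin k, hB k]

variable {M : PointedCone ℝ A}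

theorem IsArchimedean.mul_self_mem (hM : IsArchimedean M) (a : A) : a * a ∈ M := by
  simpa using hM.mul_self_mul_mem a 1 hM.one_mem

theorem IsArchimedean.algebraMap_mem (hM : IsArchimedean M) {c : ℝ} (hc : 0 ≤ c) :
    algebraMap ℝ A c ∈ M := by
  rw [Algebra.algebraMap_eq_smul_one]
  exact M.smul_mem hc hM.one_mem

theorem IsArchimedean.exists_nonneg_bound (hM : IsArchimedean M) (a : A) :
    ∃ N : ℝ, 0 ≤ N ∧ ∀ N', N ≤ N' → algebraMap ℝ A N' - a ∈ M := by
  obtain ⟨N, hN⟩ := hM.exists_bound a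
  refine ⟨max N 0, le_max_right _ _, fun N' hN' => ?_⟩
  have := add_mem hN (hM.algebraMap_mem (sub_nonneg.2 ((le_max_left _ _).trans hN')))
  simpa [map_sub] using this

theorem map_algebraMap (L : A →ₗ[ℝ] ℝ) (c : ℝ) : L (algebraMap ℝ A c) = c * L 1 := by
  rw [Algebra.algebraMap_eq_smul_one, map_smul, smul_eq_mul]

/-- A functional nonnegative on `M` stays so when multiplied by `1 - g * g ∈ M`. -/
theorem IsArchimedean.map_one_sub_mul_self_mul_nonneg (hM : IsArchimedean M) (L : A →ₗ[ℝ] ℝ)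
    (hL : ∀ m ∈ M, 0 ≤ L m) {g : A} (hg : 1 - g * g ∈ M) {m : A} (hm : m ∈ M) :
    0 ≤ L ((1 - g * g) * m) := by
  obtain ⟨N, hN0, hN⟩ := hM.exists_nonneg_bound m
  have hpow : ∀ k : ℕ, L (g ^ k * g ^ k) ≤ L 1 := by
    intro k
    induction k with
    | zero => simp
    | succ k ih =>
      have h1 := hL _ (hM.mul_self_mul_mem (g ^ k) _ hg)
      have h2 : g ^ k * g ^ k * (1 - g * g) = g ^ k * g ^ k - g ^ (k + 1) * g ^ (k + 1) := by ring
      rw [h2, map_sub] at h1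
      linarith
  -- Applied to `a ↦ L (a * m)`: since `N - m` lies in `M`, its values on even powers of `g` are at
  -- most `N` times those of `L`, which are at most `L 1`.
  have key := map_mul_self_le_of_bounded_powers (L.comp (LinearMap.mulRight ℝ m))
    (fun a => hL _ (hM.mul_self_mul_mem a m hm)) g (N * L 1) (fun k => by
      have h1 := hL _ (hM.mul_self_mul_mem (g ^ k) _ (hN N le_rfl))
      have h2 : g ^ k * g ^ k * (algebraMap ℝ A N - m) =
          N • (g ^ k * g ^ k) - g ^ k * g ^ k * m := by
        rw [Algebra.smul_def]; ring
      rw [h2, map_sub, map_smul, smul_eq_mul] at h1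
      have h3 := mul_le_mul_of_nonneg_left (hpow k) hN0
      simp only [LinearMap.comp_apply, LinearMap.mulRight_apply]
      linarith)
  simp only [LinearMap.comp_apply, LinearMap.mulRight_apply, one_mul] at key
  rw [sub_mul, one_mul, map_sub]
  linarith

/-- The normalised functionals that are nonnegative on `M`, as real functions on `A`. -/
def stateSet (M : PointedCone ℝ A) : Set (A → ℝ) :=
  {F | ∃ L : A →ₗ[ℝ] ℝ, (∀ m ∈ M, 0 ≤ L m) ∧ L 1 = 1 ∧ F = L}

/-- Tychonoff: the Archimedean bounds of `a` and `-a` confine each value to an interval, and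
linearity, normalisation and positivity are closed conditions for pointwise convergence. -/
theorem IsArchimedean.isCompact_stateSet (hM : IsArchimedean M) : IsCompact (stateSet M) := by
  choose N hN using hM.exists_bound
  have hsub : stateSet M ⊆ Set.univ.pi fun a => Set.Icc (-N (-a)) (N a) := by
    rintro F ⟨L, hL, h1, rfl⟩ a -
    have e1 := hL _ (hN a)
    have e2 := hL _ (hN (-a))
    rw [map_sub, map_algebraMap, h1] at e1 e2
    rw [map_neg] at e2
    constructor <;> linarith
  refine (isCompact_univ_pi fun a => isCompact_Icc).of_isClosed_subset ?_ hsub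
  have : stateSet M = (⋂ (a : A) (b : A), {F : A → ℝ | F (a + b) = F a + F b}) ∩
      (⋂ (c : ℝ) (a : A), {F : A → ℝ | F (c • a) = c * F a}) ∩ {F | F 1 = 1} ∩
      (⋂ m ∈ M, {F : A → ℝ | 0 ≤ F m}) := by
    ext F
    simp only [Set.mem_inter_iff, Set.mem_iInter, Set.mem_ofPred_eq]
    constructor
    · rintro ⟨L, hL, h1, rfl⟩
      exact ⟨⟨⟨fun a b => map_add L a b, fun c a => by simp⟩, h1⟩, hL⟩
    · rintro ⟨⟨⟨hadd, hsmul⟩, h1⟩, hpos⟩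
      exact ⟨⟨⟨F, hadd⟩, hsmul⟩, hpos, h1, rfl⟩
  rw [this]
  refine ((IsClosed.inter ?_ ?_).inter ?_).inter ?_
  · exact isClosed_iInter fun a => isClosed_iInter fun b =>
      isClosed_eq (by fun_prop) (by fun_prop)
  · exact isClosed_iInter fun a => isClosed_iInter fun b =>
      isClosed_eq (by fun_prop) (by fun_prop)
  · exact isClosed_eq (by fun_prop) (by fun_prop)
  · exact isClosed_iInter fun a => isClosed_iInter fun _ =>
      isClosed_le (by fun_prop) (by fun_prop)

/-- An extreme state satisfies `L (g² b) = L (g²) L b` for all `g` with `g² ≤ 1/2`. -/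
theorem IsArchimedean.map_mul_self_mul_of_extreme (hM : IsArchimedean M) {L : A →ₗ[ℝ] ℝ}
    (hL : (L : A → ℝ) ∈ (stateSet M).extremePoints ℝ) {g : A}
    (hg : algebraMap ℝ A (1 / 2) - g * g ∈ M) (b : A) : L (g * g * b) = L (g * g) * L b := by
  obtain ⟨⟨L', hpos, h1, hLL'⟩, hext⟩ := hL
  obtain rfl : L = L' := DFunLike.coe_injective hLL'
  have hg1 : 1 - g * g ∈ M := by
    have := add_mem hg (hM.algebraMap_mem (c := 1 / 2) (by norm_num))
    have e : algebraMap ℝ A (1 / 2) - g * g + algebraMap ℝ A (1 / 2) = 1 - g * g := by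
      rw [sub_add_eq_add_sub, ← map_add]; norm_num
    rwa [e] at this
  set t := L (g * g) with ht
  have ht0 : 0 ≤ t := hpos _ (hM.mul_self_mem g)
  have ht1 : t ≤ 1 / 2 := by
    have := hpos _ hg
    rw [map_sub, map_algebraMap, h1] at this
    linarith
  have ht1' : 0 < 1 - t := by linarith
  rcases ht0.eq_or_lt with h0 | h0
  -- If `L (g²) = 0`, multiplying `N - a ∈ M` by `g²` gives `L (g² a) ≤ 0` for every `a`; applied to
  -- `b` and `-b` this is a Cauchy–Schwarz substitute.
  · have hzero : ∀ a, 0 ≤ -L (g * g * a) := by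
      intro a
      obtain ⟨N, hN⟩ := hM.exists_bound a
      have h := hpos _ (hM.mul_self_mul_mem g _ hN)
      rw [mul_sub, map_sub, mul_comm, ← Algebra.smul_def, map_smul, ← ht, ← h0] at h
      simpa using h
    have h2 := hzero b
    have h3 := hzero (-b)
    rw [mul_neg, map_neg] at h3
    rw [← h0]
    linarith
  -- `L` is the proper convex combination, with weights `t` and `1 - t`, of its normalised twists by
  -- `g²` and `1 - g²`. Extremality forces `L₁ = L`, which is the claim. The bound `1/2` keeps `1 -
  -- t` positive.
  · let L₁ : A →ₗ[ℝ] ℝ := t⁻¹ • L.comp (LinearMap.mulLeft ℝ (g * g))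
    let L₂ : A →ₗ[ℝ] ℝ := (1 - t)⁻¹ • L.comp (LinearMap.mulLeft ℝ (1 - g * g))
    have hL₁ : (L₁ : A → ℝ) ∈ stateSet M := by
      refine ⟨L₁, fun m hm => ?_, ?_, rfl⟩
      · exact mul_nonneg (inv_nonneg.2 ht0) (hpos _ (hM.mul_self_mul_mem g m hm))
      · simp [L₁, ← ht, h0.ne']
    have hL₂ : (L₂ : A → ℝ) ∈ stateSet M := by
      refine ⟨L₂, fun m hm => ?_, ?_, rfl⟩
      · exact mul_nonneg (inv_nonneg.2 ht1'.le)
          (hM.map_one_sub_mul_self_mul_nonneg L hpos hg1 hm)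
      · simp [L₂, ← ht, h1, ht1'.ne']
    have hseg : (L : A → ℝ) ∈ openSegment ℝ (L₁ : A → ℝ) L₂ := by
      refine ⟨t, 1 - t, h0, ht1', by ring, ?_⟩
      funext a
      simp only [L₁, L₂, Pi.add_apply, Pi.smul_apply, LinearMap.smul_apply, LinearMap.comp_apply,
        LinearMap.mulLeft_apply, smul_eq_mul]
      rw [mul_inv_cancel_left₀ h0.ne', mul_inv_cancel_left₀ ht1'.ne', ← map_add]
      congr 1; ring
    have := congrFun (hext hL₁ hL₂ hseg) b
    simp only [L₁, LinearMap.smul_apply, LinearMap.comp_apply, LinearMap.mulLeft_apply,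
      smul_eq_mul] at this
    rw [← this, mul_inv_cancel_left₀ h0.ne']

/-- Extreme states are multiplicative. -/
theorem IsArchimedean.map_mul_of_extreme (hM : IsArchimedean M) {L : A →ₗ[ℝ] ℝ}
    (hL : (L : A → ℝ) ∈ (stateSet M).extremePoints ℝ) (a b : A) : L (a * b) = L a * L b := by
  have hsq : ∀ g : A, L (g * g * b) = L (g * g) * L b := by
    intro g
    obtain ⟨N, hN0, hN⟩ := hM.exists_nonneg_bound (g * g)
    -- Chosen so that `c * (N + 1) = 1 / 2`: the element `√c g` then has square at most `1/2`.
    set c : ℝ := 1 / (2 * (N + 1)) with hc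
    have hc0 : 0 < c := by positivity
    set e : A := algebraMap ℝ A (Real.sqrt c) * g with he
    have hee : e * e = c • (g * g) := by
      rw [he, mul_mul_mul_comm, ← map_mul, Real.mul_self_sqrt hc0.le, Algebra.smul_def]
    have hmem : algebraMap ℝ A (1 / 2) - e * e ∈ M := by
      have h := M.smul_mem hc0.le (hN (N + 1) (by linarith))
      have h2 : c • (algebraMap ℝ A (N + 1) - g * g) = algebraMap ℝ A (1 / 2) - e * e := by
        rw [smul_sub, hee, Algebra.smul_def c (algebraMap ℝ A (N + 1)), ← map_mul]
        congr 2
        rw [hc]; field_simp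
      rw [← h2]; exact h
    have h := hM.map_mul_self_mul_of_extreme hL hmem b
    rw [hee, smul_mul_assoc, map_smul, map_smul, smul_eq_mul, smul_eq_mul,
      mul_assoc c] at h
    exact mul_left_cancel₀ hc0.ne' h
  -- Polarisation: every element is a difference of scaled squares, so multiplicativity against
  -- squares is enough.
  have hdec : a = (1 / 4 : ℝ) • ((a + 1) * (a + 1)) - (1 / 4 : ℝ) • ((a - 1) * (a - 1)) := by
    have : (a + 1) * (a + 1) - (a - 1) * (a - 1) = (4 : ℝ) • a := by
      rw [Algebra.smul_def, map_ofNat]; ring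
    rw [← smul_sub, this, smul_smul]; norm_num
  rw [hdec, sub_mul, smul_mul_assoc, smul_mul_assoc]
  simp only [map_sub, map_smul, hsq, smul_eq_mul]
  ring

/-- A state which is nonpositive at `p` can be replaced by a multiplicative one. -/
theorem IsArchimedean.exists_algHom_le_zero (hM : IsArchimedean M) (L : A →ₗ[ℝ] ℝ)
    (hL : ∀ m ∈ M, 0 ≤ L m) (h1 : L 1 = 1) {p : A} (hp : L p ≤ 0) :
    ∃ φ : A →ₐ[ℝ] ℝ, (∀ m ∈ M, 0 ≤ φ m) ∧ φ p ≤ 0 := by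
  -- The face exposed by minus evaluation at `p` consists of the states minimising `p`. It is
  -- compact and nonempty, so it has an extreme point, and this is extreme among all states.
  let l : StrongDual ℝ (A → ℝ) := -ContinuousLinearMap.proj p
  have hcpt := hM.isCompact_stateSet
  have hne : (stateSet M).Nonempty := ⟨L, L, hL, h1, rfl⟩
  have hexp : IsExposed ℝ (stateSet M) (l.toExposed (stateSet M)) :=
    ContinuousLinearMap.toExposed.isExposed
  obtain ⟨F₀, hF₀, hmax⟩ := hcpt.exists_isMaxOn hne l.continuous.continuousOn
  obtain ⟨F, hF⟩ := (hexp.isCompact hcpt).extremePoints_nonempty ⟨F₀, hF₀, fun y hy => hmax hy⟩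
  have hFmin := hF.1.2 (L : A → ℝ) ⟨L, hL, h1, rfl⟩
  have hFext := hexp.isExtreme.extremePoints_subset_extremePoints hF
  obtain ⟨L', hpos, h1', rfl⟩ := hFext.1
  refine ⟨AlgHom.ofLinearMap L' h1' (hM.map_mul_of_extreme hFext), hpos, ?_⟩
  have : -L p ≤ -L' p := hFmin
  change L' p ≤ 0
  linarith

/-- **Archimedean Positivstellensatz**: an element that is positive at all real characters of `A`
which are nonnegative on `M` belongs to `M`. -/
theorem IsArchimedean.mem_of_forall_pos (hM : IsArchimedean M) {p : A}
    (hp : ∀ φ : A →ₐ[ℝ] ℝ, (∀ m ∈ M, 0 ≤ φ m) → 0 < φ p) : p ∈ M := by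
  by_contra hpM
  have hneg : (-1 : A) ∉ M := by
    intro h
    obtain ⟨N, hN0, hN⟩ := hM.exists_nonneg_bound (-p)
    have h2 := add_mem (hN N le_rfl) (M.smul_mem hN0 h)
    apply hpM
    have e : algebraMap ℝ A N - -p + N • (-1 : A) = p := by
      rw [Algebra.smul_def]; ring
    rwa [e] at h2
  -- A functional nonnegative on the cone generated by `M` and `-p`, with value `1` at `1`, is a
  -- state with `L p ≤ 0`. It is obtained by extending the identity on constants; a negative
  -- constant in the cone would put `-1` or `p` into `M`.
  let s : PointedCone ℝ A := M ⊔ PointedCone.hull ℝ {-p}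
  have hs : ∀ a ∈ s, ∃ m ∈ M, ∃ t : ℝ, 0 ≤ t ∧ a = m - t • p := by
    intro a ha
    obtain ⟨m, hm, b, hb, rfl⟩ := Submodule.mem_sup.1 ha
    obtain ⟨t, rfl⟩ := Submodule.mem_span_singleton.1 hb
    exact ⟨m, hm, t, t.2, by change m + (t : ℝ) • (-p) = _; rw [smul_neg, sub_eq_add_neg]⟩
  obtain ⟨L, hL1, hL⟩ := exists_nonneg_extension s (Algebra.linearMap ℝ A) LinearMap.id
    (by
      intro c hc
      by_contra! hc0
      obtain ⟨m, hm, t, ht, he⟩ := hs _ hc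
      simp only [LinearMap.id_apply] at hc0
      have hmem : ∀ x : ℝ, 0 ≤ x → algebraMap ℝ A x ∈ M := fun x hx => hM.algebraMap_mem hx
      have he' : t • p = m + algebraMap ℝ A (-c) := by
        rw [map_neg]
        change algebraMap ℝ A c = _ at he
        rw [he]; abel
      rcases ht.eq_or_lt with rfl | ht
      · rw [zero_smul] at he'
        have h3 := M.smul_mem (inv_nonneg.2 (by linarith : 0 ≤ -c)) hm
        apply hneg
        have e : (-c)⁻¹ • m = -1 := by
          rw [eq_neg_of_add_eq_zero_left he'.symm, smul_neg, Algebra.smul_def, ← map_mul,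
            inv_mul_cancel₀ (by linarith), map_one]
        rw [← e]; exact h3
      · apply hpM
        have h3 := M.smul_mem (inv_nonneg.2 ht.le) (add_mem hm (hmem (-c) (by linarith)))
        rw [← he'] at h3
        have e : t⁻¹ • t • p = p := inv_smul_smul₀ ht.ne' p
        rw [← e]; exact h3)
    (by
      intro a
      obtain ⟨N, hN⟩ := hM.exists_bound (-a)
      exact ⟨N, Submodule.mem_sup_left (by simpa using hN)⟩)
  have hone : L 1 = 1 := by simpa using hL1 1
  obtain ⟨φ, hφ, hφp⟩ := hM.exists_algHom_le_zero L (fun m hm => hL m (Submodule.mem_sup_left hm))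
    hone (p := p) (by
      have := hL (-p) (Submodule.mem_sup_right (Submodule.mem_span_singleton_self _))
      rw [map_neg] at this
      linarith)
  exact (hp φ hφ).not_ge hφp

/-- A functional nonnegative on `M` is nonnegative at the elements that are nonnegative at all
characters. -/
theorem IsArchimedean.map_nonneg (hM : IsArchimedean M) (L : A →ₗ[ℝ] ℝ)
    (hL : ∀ m ∈ M, 0 ≤ L m) {p : A}
    (hp : ∀ φ : A →ₐ[ℝ] ℝ, (∀ m ∈ M, 0 ≤ φ m) → 0 ≤ φ p) : 0 ≤ L p := by
  have h1 : 0 ≤ L 1 := hL _ hM.one_mem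
  refine le_of_forall_pos_le_add fun ε hε => ?_
  have hδ : 0 < ε / (L 1 + 1) := by positivity
  -- A small constant makes `p` strictly positive; the `+ 1` in the denominator covers `L 1 = 0`.
  have := hL _ (hM.mem_of_forall_pos (p := p + algebraMap ℝ A (ε / (L 1 + 1))) (fun φ hφ => by
    have := hp φ hφ
    rw [map_add, AlgHom.commutes]
    simp only [Algebra.algebraMap_self, RingHom.id_apply]
    linarith))
  rw [map_add, map_algebraMap] at this
  have h2 : ε / (L 1 + 1) * L 1 ≤ ε := by
    rw [div_mul_eq_mul_div, div_le_iff₀ (by positivity)]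
    nlinarith
  linarith

end Archimedean

/-! ### The quadratic module of a basic semialgebraic set -/

section QuadraticModule

variable {σ ι : Type*} [Fintype ι] {g : ι → MvPolynomial σ ℝ}

theorem isSumSq_C {c : ℝ} (hc : 0 ≤ c) : IsSumSq (C c : MvPolynomial σ ℝ) := by
  rw [← Real.mul_self_sqrt hc, map_mul]
  exact IsSumSq.mul_self _

theorem eval_nonneg_of_isSumSq {q : MvPolynomial σ ℝ} (hq : IsSumSq q) (z : σ → ℝ) :
    0 ≤ eval z q := by
  induction hq with
  | zero => simp
  | sq_add a _ ih =>
    rw [map_add, map_mul]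
    exact add_nonneg (mul_self_nonneg _) ih

/-- The quadratic module generated by the polynomials `gᵢ`. -/
def quadraticModule (g : ι → MvPolynomial σ ℝ) : PointedCone ℝ (MvPolynomial σ ℝ) where
  carrier := {p | ∃ (q₀ : MvPolynomial σ ℝ) (q : ι → MvPolynomial σ ℝ),
    IsSumSq q₀ ∧ (∀ i, IsSumSq (q i)) ∧ p = q₀ + ∑ i, q i * g i}
  zero_mem' := ⟨0, 0, .zero, fun _ => .zero, by simp⟩
  add_mem' := by
    rintro _ _ ⟨q₀, q, h₀, h, rfl⟩ ⟨q₀', q', h₀', h', rfl⟩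
    refine ⟨q₀ + q₀', q + q', h₀.add h₀', fun i => (h i).add (h' i), ?_⟩
    simp only [Pi.add_apply, add_mul, Finset.sum_add_distrib]
    ring
  smul_mem' := by
    rintro ⟨c, hc⟩ _ ⟨q₀, q, h₀, h, rfl⟩
    refine ⟨C c * q₀, fun i => C c * q i, (isSumSq_C hc).mul h₀, fun i => (isSumSq_C hc).mul (h i),
      ?_⟩
    change c • (q₀ + ∑ i, q i * g i) = _
    rw [smul_eq_C_mul, mul_add, Finset.mul_sum]
    simp only [mul_assoc]

theorem mem_quadraticModule_of_isSumSq {q : MvPolynomial σ ℝ} (hq : IsSumSq q) :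
    q ∈ quadraticModule g := ⟨q, 0, hq, fun _ => .zero, by simp⟩

theorem isSumSq_mul_mem_quadraticModule {q : MvPolynomial σ ℝ} (hq : IsSumSq q) (i : ι) :
    q * g i ∈ quadraticModule g := by
  classical
  refine ⟨0, Pi.single i q, .zero, fun j => ?_, ?_⟩
  · by_cases h : j = i
    · subst h; simpa using hq
    · simp [h]
  · rw [zero_add, Finset.sum_eq_single i (by intro j _ hj; simp [hj]) (by simp)]
    simp

theorem mem_quadraticModule_self (i : ι) : g i ∈ quadraticModule g := by
  simpa using isSumSq_mul_mem_quadraticModule (g := g) IsSumSq.one i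

theorem InQuadraticModule.mem_quadraticModule {k : ℕ} {p : MvPolynomial σ ℝ}
    (h : InQuadraticModule g k p) : p ∈ quadraticModule g := by
  obtain ⟨q₀, q, h₀, -, h, rfl⟩ := h
  exact ⟨q₀, q, h₀, fun i => (h i).1, rfl⟩

theorem InQuadraticModule.mono {k l : ℕ} (hkl : k ≤ l) {p : MvPolynomial σ ℝ}
    (h : InQuadraticModule g k p) : InQuadraticModule g l p := by
  obtain ⟨q₀, q, h₀, hd, h, rfl⟩ := h
  exact ⟨q₀, q, h₀, by lia, fun i => ⟨(h i).1, (h i).2.trans (by lia)⟩, rfl⟩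

theorem exists_inQuadraticModule {p : MvPolynomial σ ℝ} (h : p ∈ quadraticModule g) :
    ∃ k, InQuadraticModule g k p := by
  obtain ⟨q₀, q, h₀, h, rfl⟩ := h
  refine ⟨q₀.totalDegree + ∑ i, (q i * g i).totalDegree, q₀, q, h₀, by lia,
    fun i => ⟨h i, ?_⟩, rfl⟩
  have := Finset.single_le_sum (f := fun i => (q i * g i).totalDegree)
    (fun _ _ => Nat.zero_le _) (Finset.mem_univ i)
  lia

theorem InQuadraticModule.totalDegree_le {k : ℕ} {p : MvPolynomial σ ℝ}
    (h : InQuadraticModule g k p) : p.totalDegree ≤ 2 * k := by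
  obtain ⟨q₀, q, -, hd, h, rfl⟩ := h
  exact (totalDegree_add _ _).trans (max_le hd (totalDegree_finsetSum_le fun i _ => (h i).2))

theorem eval_nonneg_of_mem_quadraticModule {p : MvPolynomial σ ℝ} (h : p ∈ quadraticModule g)
    {z : σ → ℝ} (hz : z ∈ semialgSet g) : 0 ≤ eval z p := by
  obtain ⟨q₀, q, h₀, h, rfl⟩ := h
  rw [map_add, map_sum]
  refine add_nonneg (eval_nonneg_of_isSumSq h₀ z) (Finset.sum_nonneg fun i _ => ?_)
  rw [map_mul]
  exact mul_nonneg (eval_nonneg_of_isSumSq (h i) z) (hz i)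

theorem mul_self_mul_mem_quadraticModule (a : MvPolynomial σ ℝ) {p : MvPolynomial σ ℝ}
    (h : p ∈ quadraticModule g) : a * a * p ∈ quadraticModule g := by
  obtain ⟨q₀, q, h₀, h, rfl⟩ := h
  refine ⟨a * a * q₀, fun i => a * a * q i, (IsSumSq.mul_self a).mul h₀,
    fun i => (IsSumSq.mul_self a).mul (h i), ?_⟩
  rw [mul_add, Finset.mul_sum]
  simp only [mul_assoc]

theorem C_mem_quadraticModule {c : ℝ} (hc : 0 ≤ c) : C c ∈ quadraticModule g :=
  mem_quadraticModule_of_isSumSq (isSumSq_C hc)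

/-- Every coordinate is bounded with respect to the quadratic module. -/
def BoundsCoordinates (g : ι → MvPolynomial σ ℝ) : Prop :=
  ∀ j, ∃ R : ℝ, C (R ^ 2) - X j ^ 2 ∈ quadraticModule g

/-- Elements bounded on both sides are closed under sums. Their squares are bounded above because
`2N(N² - p²) = (N - p)²(N + p) + (N + p)²(N - p)`, and products follow by polarisation, so bounding
the coordinates is enough. -/
theorem BoundsCoordinates.exists_bound (hg : BoundsCoordinates g) (p : MvPolynomial σ ℝ) :
    ∃ N : ℝ, 0 < N ∧ C N - p ∈ quadraticModule g ∧ C N + p ∈ quadraticModule g := by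
  have hsq : ∀ p : MvPolynomial σ ℝ,
      (∃ N : ℝ, 0 < N ∧ C N - p ∈ quadraticModule g ∧ C N + p ∈ quadraticModule g) →
      ∃ N : ℝ, 0 < N ∧ C N - p * p ∈ quadraticModule g := by
    rintro p ⟨N, hN, h1, h2⟩
    refine ⟨N ^ 2, by positivity, ?_⟩
    have h3 := add_mem (mul_self_mul_mem_quadraticModule (C N - p) h2)
      (mul_self_mul_mem_quadraticModule (C N + p) h1)
    have h4 := (quadraticModule g).smul_mem (r := (2 * N)⁻¹) (by positivity) h3
    have e : (2 * N)⁻¹ • ((C N - p) * (C N - p) * (C N + p) + (C N + p) * (C N + p) * (C N - p)) =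
        C (N ^ 2) - p * p := by
      have h5 : (C N - p) * (C N - p) * (C N + p) + (C N + p) * (C N + p) * (C N - p) =
          C (2 * N) * (C (N ^ 2) - p * p) := by
        simp only [map_mul, map_pow, map_ofNat]; ring
      rw [h5, ← smul_eq_C_mul, inv_smul_smul₀ (by positivity)]
    rwa [e] at h4
  have hadd : ∀ p q : MvPolynomial σ ℝ,
      (∃ N : ℝ, 0 < N ∧ C N - p ∈ quadraticModule g ∧ C N + p ∈ quadraticModule g) →
      (∃ N : ℝ, 0 < N ∧ C N - q ∈ quadraticModule g ∧ C N + q ∈ quadraticModule g) →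
      ∃ N : ℝ, 0 < N ∧ C N - (p + q) ∈ quadraticModule g ∧ C N + (p + q) ∈ quadraticModule g := by
    rintro p q ⟨N, hN, h1, h2⟩ ⟨N', hN', h1', h2'⟩
    refine ⟨N + N', by positivity, ?_, ?_⟩
    · convert! add_mem h1 h1' using 1
      rw [map_add]; ring
    · convert! add_mem h2 h2' using 1
      rw [map_add]; ring
  induction p using MvPolynomial.induction_on with
  | C a =>
    refine ⟨|a| + 1, by positivity, ?_, ?_⟩
    · rw [← map_sub]; exact C_mem_quadraticModule (by linarith [le_abs_self a])
    · rw [← map_add]; exact C_mem_quadraticModule (by linarith [neg_abs_le a])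
  | add p q hp hq => exact hadd p q hp hq
  | mul_X p j hp =>
    have hX : ∃ N : ℝ, 0 < N ∧ C N - X j ∈ quadraticModule g ∧ C N + X j ∈ quadraticModule g := by
      obtain ⟨R, hR⟩ := hg j
      -- `1/4 + R² ∓ X = (R² - X²) + (X ∓ 1/2)²`.
      refine ⟨1 / 4 + R ^ 2, by positivity, ?_, ?_⟩
      · convert! add_mem hR (mem_quadraticModule_of_isSumSq (IsSumSq.mul_self (X j - C (1 / 2))))
          using 1
        have : (C (1 / 4) : MvPolynomial σ ℝ) = C (1 / 2) * C (1 / 2) := by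
          rw [← map_mul]; norm_num
        have h2 : (C (1 / 2) : MvPolynomial σ ℝ) * 2 = 1 := by
          rw [← map_ofNat C 2, ← map_mul]; norm_num
        rw [map_add, this]; linear_combination (-X j : MvPolynomial σ ℝ) * (-h2)
      · convert! add_mem hR (mem_quadraticModule_of_isSumSq (IsSumSq.mul_self (X j + C (1 / 2))))
          using 1
        have : (C (1 / 4) : MvPolynomial σ ℝ) = C (1 / 2) * C (1 / 2) := by
          rw [← map_mul]; norm_num
        have h2 : (C (1 / 2) : MvPolynomial σ ℝ) * 2 = 1 := by
          rw [← map_ofNat C 2, ← map_mul]; norm_num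
        rw [map_add, this]; linear_combination (X j : MvPolynomial σ ℝ) * (-h2)
    obtain ⟨N, hN, h⟩ := hsq _ (hadd _ _ hp hX)
    have hX' : ∃ N : ℝ, 0 < N ∧ C N - -X j ∈ quadraticModule g ∧
        C N + -X j ∈ quadraticModule g := by
      obtain ⟨N, hN, h1, h2⟩ := hX
      exact ⟨N, hN, by simpa using h2, by simpa [sub_eq_add_neg] using h1⟩
    obtain ⟨N', hN', h'⟩ := hsq _ (hadd _ _ hp hX')
    -- `4pX = (p + X)² - (p - X)²`, where one square is bounded by `N` or `N'` and the other lies in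
    -- the module; adding the remaining constant lets the same bound serve both signs.
    refine ⟨(N + N') / 4, by positivity, ?_, ?_⟩
    · have h3 := (quadraticModule g).smul_mem (r := 4⁻¹) (by positivity) (add_mem h
        (add_mem (mem_quadraticModule_of_isSumSq (IsSumSq.mul_self (p + -X j)))
          (C_mem_quadraticModule hN'.le)))
      convert! h3 using 1
      rw [eq_inv_smul_iff₀ (by norm_num), smul_eq_C_mul, mul_sub, ← map_mul,
        mul_div_cancel₀ _ (by norm_num : (4 : ℝ) ≠ 0), map_add, map_ofNat]
      ring
    · have h3 := (quadraticModule g).smul_mem (r := 4⁻¹) (by positivity) (add_mem h'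
        (add_mem (mem_quadraticModule_of_isSumSq (IsSumSq.mul_self (p + X j)))
          (C_mem_quadraticModule hN.le)))
      convert! h3 using 1
      rw [eq_inv_smul_iff₀ (by norm_num), smul_eq_C_mul, mul_add, ← map_mul,
        mul_div_cancel₀ _ (by norm_num : (4 : ℝ) ≠ 0), map_add, map_ofNat]
      ring

theorem BoundsCoordinates.isArchimedean (hg : BoundsCoordinates g) :
    IsArchimedean (quadraticModule g) where
  one_mem := mem_quadraticModule_of_isSumSq IsSumSq.one
  mul_self_mul_mem a _ hm := mul_self_mul_mem_quadraticModule a hm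
  exists_bound a := by
    obtain ⟨N, -, h, -⟩ := hg.exists_bound a
    exact ⟨N, h⟩

theorem isClosed_semialgSet {σ ι : Type*} (g : ι → MvPolynomial σ ℝ) : IsClosed (semialgSet g) := by
  have : semialgSet g = ⋂ i, {z | 0 ≤ eval z (g i)} := by ext; simp [semialgSet]
  rw [this]
  exact isClosed_iInter fun i => isClosed_le continuous_const (continuous_eval _)

theorem BoundsCoordinates.isCompact (hg : BoundsCoordinates g) : IsCompact (semialgSet g) := by
  choose R hR using hg
  refine (isCompact_univ_pi fun j => isCompact_Icc (a := -|R j|) (b := |R j|)).of_isClosed_subset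
    (isClosed_semialgSet g) fun z hz j _ => ?_
  have h := eval_nonneg_of_mem_quadraticModule (hR j) hz
  simp only [map_sub, eval_C, map_pow, eval_X] at h
  exact abs_le.1 (sq_le_sq.1 (by linarith))

/-- A functional nonnegative on the quadratic module is nonnegative at the polynomials that are
nonnegative on the semialgebraic set. -/
theorem BoundsCoordinates.map_nonneg (hg : BoundsCoordinates g) (L : MvPolynomial σ ℝ →ₗ[ℝ] ℝ)
    (hL : ∀ m ∈ quadraticModule g, 0 ≤ L m) {p : MvPolynomial σ ℝ}
    (hp : ∀ z ∈ semialgSet g, 0 ≤ eval z p) : 0 ≤ L p := by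
  refine hg.isArchimedean.map_nonneg L hL fun φ hφ => ?_
  -- A character is evaluation at the images of the variables; nonnegativity on each `g i` puts that
  -- point in the semialgebraic set.
  have hφ' : ∀ p, φ p = eval (φ ∘ X) p := fun p => by
    conv_lhs => rw [aeval_unique φ]
    rw [← coe_aeval_eq_eval]; rfl
  rw [hφ']
  exact hp _ fun i => by rw [← hφ']; exact hφ _ (mem_quadraticModule_self i)

open CompactlySupported in
/-- The restriction of polynomials to a compact set. -/
def polynomialRestriction (K : Set (σ → ℝ)) [CompactSpace K] :
    MvPolynomial σ ℝ →ₗ[ℝ] C_c(K, ℝ) where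
  toFun p := ⟨⟨fun z => eval z.1 p, (continuous_eval p).comp continuous_subtype_val⟩,
    HasCompactSupport.of_compactSpace _⟩
  map_add' p q := by ext; simp
  map_smul' c p := by ext; simp [smul_eval]

open CompactlySupported in
/-- The nonnegative functions on a compact set. -/
def nonnegCone (K : Set (σ → ℝ)) : PointedCone ℝ C_c(K, ℝ) where
  carrier := {F | ∀ z, 0 ≤ F z}
  zero_mem' := fun _ => le_rfl
  add_mem' := fun hF hG z => add_nonneg (hF z) (hG z)
  smul_mem' := fun c _ hF z => mul_nonneg c.2 (hF z)

/-- **Putinar's theorem**: a functional nonnegative on the quadratic module is given by a measure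
on the semialgebraic set. -/
theorem BoundsCoordinates.exists_measure [Fintype σ] (hg : BoundsCoordinates g)
    (L : MvPolynomial σ ℝ →ₗ[ℝ] ℝ) (hL : ∀ m ∈ quadraticModule g, 0 ≤ L m) :
    ∃ ν : Measure (σ → ℝ), IsFiniteMeasure ν ∧ ν (semialgSet g)ᶜ = 0 ∧
      ∀ p, L p = ∫ z, eval z p ∂ν := by
  set K := semialgSet g with hK
  have hKc : IsCompact K := hg.isCompact
  have : CompactSpace K := isCompact_iff_compactSpace.1 hKc
  -- Restriction to `K` need not be injective, which the extension along a linear map permits.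
  -- Constants dominate `C(K)` by compactness, and Riesz–Markov represents the extension.
  obtain ⟨Λ, hΛ, hpos⟩ := exists_nonneg_extension (nonnegCone K)
    (polynomialRestriction K) L
    (fun p hp => hg.map_nonneg L hL fun z hz => hp ⟨z, hz⟩)
    (by
      intro F
      obtain ⟨N, hN⟩ := (isCompact_range F.continuous).bddBelow
      refine ⟨C (-N), fun z => ?_⟩
      have : N ≤ F z := hN ⟨z, rfl⟩
      simp only [polynomialRestriction, LinearMap.coe_mk, AddHom.coe_mk,
        CompactlySupportedContinuousMap.coe_add, CompactlySupportedContinuousMap.coe_mk,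
        ContinuousMap.coe_mk, Pi.add_apply, eval_C]
      linarith)
  let Λ' := PositiveLinearMap.mk₀ Λ fun F hF => hpos F hF
  refine ⟨(RealRMK.rieszMeasure Λ').map Subtype.val, inferInstance, ?_, fun p => ?_⟩
  · rw [Measure.map_apply measurable_subtype_coe hKc.measurableSet.compl]
    simp
  · rw [integral_map measurable_subtype_coe.aemeasurable
      (continuous_eval p).aestronglyMeasurable, ← hΛ]
    exact (RealRMK.integral_rieszMeasure Λ' (polynomialRestriction K p)).symm

end QuadraticModule

/-! ### Integrals over compact sets -/

theorem riesz_lebesgueMoment {n : ℕ} {K : Set (Fin n → ℝ)} (hK : IsCompact K)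
    (p : MvPolynomial (Fin n) ℝ) : riesz (lebesgueMoment K) p = ∫ x in K, eval x p := by
  simp only [riesz, lebesgueMoment, eval_eq']
  rw [integral_finsetSum]
  · simp only [integral_const_mul]
  · intro a _
    exact (Continuous.continuousOn (by fun_prop)).integrableOn_compact hK

/-- A polynomial approximates a continuous function uniformly on a compact set. -/
theorem exists_polynomial_near {σ : Type*} {K : Set (σ → ℝ)} (hK : IsCompact K)
    {w : (σ → ℝ) → ℝ} (hw : ContinuousOn w K) {ε : ℝ} (hε : 0 < ε) :
    ∃ p : MvPolynomial σ ℝ, ∀ x ∈ K, |eval x p - w x| < ε := by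
  have : CompactSpace K := isCompact_iff_compactSpace.1 hK
  let Φ : MvPolynomial σ ℝ →ₐ[ℝ] C(K, ℝ) :=
    aeval fun j => ⟨fun z => z.1 j, (continuous_apply j).comp continuous_subtype_val⟩
  have hΦ : ∀ p (z : K), Φ p z = eval z.1 p := by
    intro p z
    induction p using MvPolynomial.induction_on with
    | C a => simp [Φ]
    | add p q hp hq => simp [hp, hq]
    | mul_X p j hp => rw [map_mul, ContinuousMap.mul_apply, hp]; simp [Φ]
  obtain ⟨⟨_, p, rfl⟩, hp⟩ :=
    ContinuousMap.exists_mem_subalgebra_near_continuous_of_separatesPoints Φ.range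
    (by
      intro x y hxy
      obtain ⟨j, hj⟩ := Function.ne_iff.1 (fun h => hxy (Subtype.ext h))
      refine ⟨_, ⟨Φ (X j), ⟨X j, rfl⟩, rfl⟩, ?_⟩
      simpa [hΦ] using hj)
    (K.domRestrict w) hw.domRestrict ε hε
  refine ⟨p, fun x hx => ?_⟩
  have h := hp ⟨x, hx⟩
  rw [← hΦ p ⟨x, hx⟩]
  exact h

/-! ### Linear functionals of sequences -/

section Riesz

variable {σ : Type*}

/-- `riesz y` as a linear map. -/
def rieszLinear (y : (σ →₀ ℕ) → ℝ) : MvPolynomial σ ℝ →ₗ[ℝ] ℝ :=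
  (basisMonomials σ ℝ).constr ℝ y

theorem rieszLinear_monomial (y : (σ →₀ ℕ) → ℝ) (a : σ →₀ ℕ) (c : ℝ) :
    rieszLinear y (monomial a c) = c * y a := by
  have h : monomial a c = c • (basisMonomials σ ℝ) a := by
    rw [coe_basisMonomials, smul_monomial, smul_eq_mul, mul_one]
  rw [h, map_smul, rieszLinear, Module.Basis.constr_basis, smul_eq_mul]

theorem rieszLinear_C (y : (σ →₀ ℕ) → ℝ) (c : ℝ) : rieszLinear y (C c) = c * y 0 := by
  rw [← monomial_zero', rieszLinear_monomial]

theorem rieszLinear_one (y : (σ →₀ ℕ) → ℝ) : rieszLinear y 1 = y 0 := by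
  rw [← C_1, rieszLinear_C, one_mul]

theorem rieszLinear_apply (y : (σ →₀ ℕ) → ℝ) (p : MvPolynomial σ ℝ) :
    rieszLinear y p = riesz y p := by
  conv_lhs => rw [← support_sum_monomial_coeff p]
  rw [map_sum]
  exact Finset.sum_congr rfl fun a _ => rieszLinear_monomial y a _

theorem continuous_rieszLinear (p : MvPolynomial σ ℝ) :
    Continuous fun y : (σ →₀ ℕ) → ℝ => rieszLinear y p := by
  simp only [rieszLinear_apply, riesz]
  fun_prop

theorem degree_le_of_mem_support {p : MvPolynomial σ ℝ} {k : ℕ} (hp : p.totalDegree ≤ k)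
    {a : σ →₀ ℕ} (ha : a ∈ p.support) : a.degree ≤ k :=
  (le_totalDegree ha).trans hp

theorem totalDegree_monomial_le_degree (a : σ →₀ ℕ) (c : ℝ) :
    (monomial a c).totalDegree ≤ a.degree :=
  totalDegree_monomial_le a c

theorem rieszLinear_congr {y y' : (σ →₀ ℕ) → ℝ} {k : ℕ} (h : ∀ a, a.degree ≤ k → y a = y' a)
    {p : MvPolynomial σ ℝ} (hp : p.totalDegree ≤ k) : rieszLinear y p = rieszLinear y' p := by
  simp only [rieszLinear_apply, riesz]
  exact Finset.sum_congr rfl fun a ha => by rw [h a (degree_le_of_mem_support hp ha)]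

/-- The sequence of moments of degree at most `k` of a linear functional. -/
def truncatedMoments (k : ℕ) (L : MvPolynomial σ ℝ →ₗ[ℝ] ℝ) (a : σ →₀ ℕ) : ℝ :=
  if a.degree ≤ k then L (monomial a 1) else 0

theorem rieszLinear_truncatedMoments {k : ℕ} (L : MvPolynomial σ ℝ →ₗ[ℝ] ℝ)
    {p : MvPolynomial σ ℝ} (hp : p.totalDegree ≤ k) :
    rieszLinear (truncatedMoments k L) p = L p := by
  rw [rieszLinear_congr (y := truncatedMoments k L) (y' := fun a => L (monomial a 1)) (fun a ha => if_pos ha) hp]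
  conv_rhs => rw [← support_sum_monomial_coeff p]
  rw [map_sum, rieszLinear_apply]
  refine Finset.sum_congr rfl fun a _ => ?_
  have h : monomial a (coeff a p) = coeff a p • monomial a 1 := by
    rw [smul_monomial, smul_eq_mul, mul_one]
  rw [h, map_smul, smul_eq_mul]

end Riesz

/-! ### Positive semidefinite localizing matrices -/

section Localizing

variable {σ ι : Type*}

/-- The quadratic form of the matrix at the coefficient vector of `h` is the value of the functional
at `h² g`. This replaces matrices by functionals from here on. -/
theorem localizingMatrix_posSemidef_iff {k : ℕ} {g : MvPolynomial σ ℝ} {y : (σ →₀ ℕ) → ℝ} :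
    (localizingMatrix k g y).PosSemidef ↔
      ∀ h : MvPolynomial σ ℝ, h.totalDegree ≤ k → 0 ≤ rieszLinear y (h * h * g) := by
  let P : ({a : σ →₀ ℕ // a.degree ≤ k} →₀ ℝ) →ₗ[ℝ] MvPolynomial σ ℝ :=
    Finsupp.linearCombination ℝ fun a => monomial a.1 1
  have hquad : ∀ x, (x.sum fun i xi ↦ x.sum fun j xj ↦ star xi * localizingMatrix k g y i j * xj) =
      rieszLinear y (P x * P x * g) := by
    intro x
    simp only [P, Finsupp.linearCombination_apply, Finsupp.sum, Finset.sum_mul, Finset.mul_sum,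
      map_sum]
    refine Finset.sum_congr rfl fun i _ => Finset.sum_congr rfl fun j _ => ?_
    have : x i • (monomial i.1) (1 : ℝ) * x j • (monomial j.1) 1 * g =
        (x i * x j) • (monomial (i.1 + j.1) 1 * g) := by
      rw [smul_mul_smul_comm, monomial_mul, one_mul, smul_mul_assoc]
    rw [mul_comm (x j • _), this, map_smul, rieszLinear_apply]
    simp only [localizingMatrix, Matrix.of_apply, star_trivial, smul_eq_mul]
    ring
  constructor
  · rintro ⟨-, hpos⟩ h hh
    let x : {a : σ →₀ ℕ // a.degree ≤ k} →₀ ℝ := ∑ a ∈ h.support.attach,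
      Finsupp.single ⟨a.1, degree_le_of_mem_support hh a.2⟩ (coeff a.1 h)
    have hx : P x = h := by
      simp only [x, P, map_sum, Finsupp.linearCombination_single, smul_monomial, smul_eq_mul,
        mul_one]
      rw [Finset.sum_attach h.support fun a => monomial a (coeff a h), support_sum_monomial_coeff]
    have := hpos x
    rwa [hquad, hx] at this
  · intro H
    refine ⟨?_, fun x => ?_⟩
    · ext a b
      simp [localizingMatrix, add_comm]
    · rw [hquad]
      refine H _ ?_
      simp only [P, Finsupp.linearCombination_apply, Finsupp.sum]
      refine totalDegree_finsetSum_le fun a _ => ?_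
      rw [smul_monomial]
      exact (totalDegree_monomial_le_degree _ _).trans a.2

theorem momentMatrix_eq_localizingMatrix (k : ℕ) (y : (σ →₀ ℕ) → ℝ) :
    momentMatrix k y = localizingMatrix k 1 y := by
  ext a b
  simp [momentMatrix, localizingMatrix, ← rieszLinear_apply, rieszLinear_monomial]

theorem isPseudoMoment_iff {g : ι → MvPolynomial σ ℝ} {k : ℕ} {y : (σ →₀ ℕ) → ℝ} :
    IsPseudoMoment g k y ↔ (∀ a : σ →₀ ℕ, 2 * k < a.degree → y a = 0) ∧
      (∀ h : MvPolynomial σ ℝ, h.totalDegree ≤ k → 0 ≤ rieszLinear y (h * h)) ∧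
      ∀ i, halfDegree (g i) ≤ k → ∀ h : MvPolynomial σ ℝ, h.totalDegree ≤ k - halfDegree (g i) →
        0 ≤ rieszLinear y (h * h * g i) := by
  simp only [IsPseudoMoment, momentMatrix_eq_localizingMatrix, localizingMatrix_posSemidef_iff,
    mul_one]

theorem isClosed_isPseudoMoment (g : ι → MvPolynomial σ ℝ) (k : ℕ) :
    IsClosed {y | IsPseudoMoment g k y} := by
  simp only [isPseudoMoment_iff, Set.ofPred_and, Set.ofPred_forall]
  refine IsClosed.inter ?_ (IsClosed.inter ?_ ?_)
  · exact isClosed_iInter fun a => isClosed_iInter fun _ =>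
      isClosed_eq (continuous_apply a) continuous_const
  · exact isClosed_iInter fun h => isClosed_iInter fun _ =>
      isClosed_le continuous_const (continuous_rieszLinear _)
  · exact isClosed_iInter fun i => isClosed_iInter fun _ => isClosed_iInter fun h =>
      isClosed_iInter fun _ => isClosed_le continuous_const (continuous_rieszLinear _)

theorem totalDegree_mul_self_le {h : MvPolynomial σ ℝ} {k : ℕ} (hh : h.totalDegree ≤ k) :
    (h * h).totalDegree ≤ 2 * k :=
  (totalDegree_mul _ _).trans (by lia)

theorem totalDegree_mul_self_mul_le {h g : MvPolynomial σ ℝ} {k : ℕ} (hg : halfDegree g ≤ k)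
    (hh : h.totalDegree ≤ k - halfDegree g) : (h * h * g).totalDegree ≤ 2 * k := by
  refine (totalDegree_mul _ _).trans ?_
  have := totalDegree_mul_self_le hh
  rw [halfDegree] at *
  lia

/-- Truncating a pseudo-moment sequence. -/
theorem IsPseudoMoment.truncate {g : ι → MvPolynomial σ ℝ} {k l : ℕ} (hlk : l ≤ k)
    {y : (σ →₀ ℕ) → ℝ} (hy : IsPseudoMoment g k y) :
    IsPseudoMoment g l (truncatedMoments (2 * l) (rieszLinear y)) := by
  rw [isPseudoMoment_iff] at hy ⊢
  obtain ⟨-, h1, h2⟩ := hy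
  refine ⟨fun a ha => if_neg (by lia), fun h hh => ?_, fun i hi h hh => ?_⟩
  · rw [rieszLinear_truncatedMoments _ (totalDegree_mul_self_le hh)]
    exact h1 h (hh.trans hlk)
  · rw [rieszLinear_truncatedMoments _ (totalDegree_mul_self_mul_le hi hh)]
    exact h2 i (hi.trans hlk) h (hh.trans (by lia))

/-- The truncated moments of a functional that is nonnegative on the quadratic module. -/
theorem isPseudoMoment_truncatedMoments [Fintype ι] {g : ι → MvPolynomial σ ℝ}
    {L : MvPolynomial σ ℝ →ₗ[ℝ] ℝ} (hL : ∀ m ∈ quadraticModule g, 0 ≤ L m) (k : ℕ) :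
    IsPseudoMoment g k (truncatedMoments (2 * k) L) := by
  rw [isPseudoMoment_iff]
  refine ⟨fun a ha => if_neg (by lia), fun h hh => ?_, fun i hi h hh => ?_⟩
  · rw [rieszLinear_truncatedMoments _ (totalDegree_mul_self_le hh)]
    exact hL _ (mem_quadraticModule_of_isSumSq (IsSumSq.mul_self h))
  · rw [rieszLinear_truncatedMoments _ (totalDegree_mul_self_mul_le hi hh)]
    exact hL _ (isSumSq_mul_mem_quadraticModule (IsSumSq.mul_self h) i)

/-- Sums of squares have positive leading coefficients, so the degrees of the summands do not
exceed the degree of the sum. -/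
theorem totalDegree_le_of_isSumSq_add [Finite σ] {p q : MvPolynomial σ ℝ} (hp : IsSumSq p)
    (hq : IsSumSq q) :
    p.totalDegree ≤ (p + q).totalDegree ∧ q.totalDegree ≤ (p + q).totalDegree := by
  have := Fintype.ofFinite σ
  let _ : LinearOrder σ := LinearOrder.lift' (Fintype.equivFin σ) (Fintype.equivFin σ).injective
  have key : ∀ p q : MvPolynomial σ ℝ, (p = 0 ∨ 0 < MonomialOrder.degLex.leadingCoeff p) →
      (q = 0 ∨ 0 < MonomialOrder.degLex.leadingCoeff q) →
      (p + q = 0 ∨ 0 < MonomialOrder.degLex.leadingCoeff (p + q)) ∧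
      p.totalDegree ≤ (p + q).totalDegree ∧ q.totalDegree ≤ (p + q).totalDegree := by
    have lt_case : ∀ p q : MvPolynomial σ ℝ, 0 < MonomialOrder.degLex.leadingCoeff p →
        MonomialOrder.degLex.toSyn (MonomialOrder.degLex.degree q) <
          MonomialOrder.degLex.toSyn (MonomialOrder.degLex.degree p) →
        0 < MonomialOrder.degLex.leadingCoeff (p + q) ∧
        p.totalDegree ≤ (p + q).totalDegree ∧ q.totalDegree ≤ (p + q).totalDegree := by
      intro p q hp hlt
      have hd := MonomialOrder.degree_add_of_lt hlt
      refine ⟨by rwa [MonomialOrder.leadingCoeff_add_of_lt hlt],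
        degLex_totalDegree_monotone (by rw [hd]), degLex_totalDegree_monotone (by rw [hd]; exact hlt.le)⟩
    rintro p q (rfl | hp) hq
    · simpa using hq
    rcases hq with rfl | hq
    · simpa using Or.inr hp
    rcases lt_trichotomy (MonomialOrder.degLex.toSyn (MonomialOrder.degLex.degree p))
      (MonomialOrder.degLex.toSyn (MonomialOrder.degLex.degree q)) with hlt | heq | hlt
    · obtain ⟨h1, h2, h3⟩ := lt_case q p hq hlt
      rw [add_comm q p] at h1 h2 h3
      exact ⟨.inr h1, h3, h2⟩
    -- With equal leading monomials the positive leading coefficients add up and cannot cancel.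
    · have heq' : MonomialOrder.degLex.degree p = MonomialOrder.degLex.degree q :=
        MonomialOrder.degLex.toSyn.injective heq
      have hc : 0 < coeff (MonomialOrder.degLex.degree p) (p + q) := by
        rw [coeff_add]
        refine add_pos hp ?_
        rw [heq']; exact hq
      have hle := MonomialOrder.degLex.le_degree (f := p + q) (mem_support_iff.2 hc.ne')
      have hge : MonomialOrder.degLex.toSyn (MonomialOrder.degLex.degree (p + q)) ≤
          MonomialOrder.degLex.toSyn (MonomialOrder.degLex.degree p) := by
        refine MonomialOrder.degree_add_le.trans ?_
        rw [← heq, sup_idem]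
      have hdeg : MonomialOrder.degLex.degree (p + q) = MonomialOrder.degLex.degree p :=
        MonomialOrder.degLex.toSyn.injective (le_antisymm hge hle)
      refine ⟨.inr ?_, degLex_totalDegree_monotone hle, degLex_totalDegree_monotone ?_⟩
      · rw [MonomialOrder.leadingCoeff, hdeg]; exact hc
      · rw [← heq]; exact hle
    · obtain ⟨h1, h2, h3⟩ := lt_case p q hp hlt
      exact ⟨.inr h1, h2, h3⟩
  have hpos : ∀ p : MvPolynomial σ ℝ, IsSumSq p →
      p = 0 ∨ 0 < MonomialOrder.degLex.leadingCoeff p := by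
    intro p hp
    induction hp with
    | zero => exact .inl rfl
    | sq_add a _ ih =>
      refine (key _ _ ?_ ih).1
      rw [MonomialOrder.leadingCoeff_mul]
      by_cases ha : a = 0
      · simp [ha]
      · exact .inr (mul_self_pos.2 (MonomialOrder.leadingCoeff_ne_zero_iff.2 ha))
  exact (key p q (hpos p hp) (hpos q hq)).2

/-- Without cancellation of leading terms each square `a²` in `q` has degree at most `deg q`, hence
`deg a ≤ d`. The slack `2 * d + 1` is harmless because squares have even degree, and it is needed
when `deg g` is odd. -/
theorem rieszLinear_isSumSq_mul_nonneg [Finite σ] {y : (σ →₀ ℕ) → ℝ} {g : MvPolynomial σ ℝ}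
    {d : ℕ} (hy : ∀ h : MvPolynomial σ ℝ, h.totalDegree ≤ d → 0 ≤ rieszLinear y (h * h * g))
    {q : MvPolynomial σ ℝ} (hq : IsSumSq q) (hd : q.totalDegree ≤ 2 * d + 1) :
    0 ≤ rieszLinear y (q * g) := by
  induction hq with
  | zero => simp
  | @sq_add a s hs ih =>
    obtain ⟨h1, h2⟩ := totalDegree_le_of_isSumSq_add (IsSumSq.mul_self a) hs
    rw [add_mul, map_add]
    refine add_nonneg (hy a ?_) (ih (h2.trans hd))
    by_cases ha : a = 0
    · simp [ha]
    · rw [totalDegree_mul_of_isDomain ha ha] at h1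
      lia

/-- Pseudo-moments are nonnegative on the truncated quadratic module. -/
theorem IsPseudoMoment.rieszLinear_nonneg [Finite σ] [Fintype ι] {g : ι → MvPolynomial σ ℝ} {k : ℕ}
    {y : (σ →₀ ℕ) → ℝ} (hy : IsPseudoMoment g k y) {p : MvPolynomial σ ℝ}
    (hp : InQuadraticModule g k p) : 0 ≤ rieszLinear y p := by
  rw [isPseudoMoment_iff] at hy
  obtain ⟨-, h1, h2⟩ := hy
  obtain ⟨q₀, q, hq₀, hd₀, hq, rfl⟩ := hp
  rw [map_add, map_sum]
  refine add_nonneg ?_ (Finset.sum_nonneg fun i _ => ?_)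
  · have := rieszLinear_isSumSq_mul_nonneg (g := 1) (y := y) (d := k) (by simpa using h1) hq₀
      (by lia)
    simpa using this
  -- A nonzero term forces `deg (g i) ≤ 2 * k`, so the localizing condition for `g i` is really
  -- imposed.
  · by_cases h0 : q i * g i = 0
    · simp [h0]
    · have hdeg := (hq i).2
      rw [totalDegree_mul_of_isDomain (left_ne_zero_of_mul h0) (right_ne_zero_of_mul h0)] at hdeg
      have hhalf : halfDegree (g i) ≤ k := by rw [halfDegree]; lia
      refine rieszLinear_isSumSq_mul_nonneg (h2 i hhalf) (hq i).1 ?_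
      rw [halfDegree] at *
      lia

end Localizing

/-! ### Bounds for pseudo-moments -/

section Bounds

variable {σ ι : Type*}

/-- Every variable occurs in a constraint `R² - ∑ xₗ² ≥ 0`. -/
def HasBallCover (g : ι → MvPolynomial σ ℝ) : Prop :=
  ∀ j, ∃ i, ∃ (R : ℝ) (s : Finset σ), j ∈ s ∧ g i = C (R ^ 2) - ∑ l ∈ s, X l ^ 2

theorem HasBallConstraint.hasBallCover [Fintype σ] {g : ι → MvPolynomial σ ℝ}
    (hg : HasBallConstraint g) : HasBallCover g := by
  obtain ⟨i, R, hi⟩ := hg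
  exact fun j => ⟨i, R, Finset.univ, Finset.mem_univ j, hi⟩

/-- The product has one ball per block of variables and not a ball in all of them, hence the
formulation with subsets of variables. -/
theorem hasBallCover_productConstraints {n m nX nU : ℕ} {gX : Fin nX → MvPolynomial (Fin n) ℝ}
    {gU : Fin nU → MvPolynomial (Fin m) ℝ} (hX : HasBallConstraint gX)
    (hU : HasBallConstraint gU) : HasBallCover (productConstraints gX gU) := by
  obtain ⟨i, R, hi⟩ := hX
  obtain ⟨i', R', hi'⟩ := hU
  rintro (j | j)
  · exact ⟨.inl i, R, Finset.univ.map .inl, by simp, by simp [productConstraints, hi]⟩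
  · exact ⟨.inr i', R', Finset.univ.map .inr, by simp, by simp [productConstraints, hi']⟩

theorem HasBallCover.boundsCoordinates [Fintype ι] {g : ι → MvPolynomial σ ℝ}
    (hg : HasBallCover g) : BoundsCoordinates g := by
  classical
  intro j
  obtain ⟨i, R, s, hj, hi⟩ := hg j
  refine ⟨R, ?_⟩
  have h := add_mem (mem_quadraticModule_self (g := g) i) (mem_quadraticModule_of_isSumSq
    (IsSumSq.sum_sq (s.erase j) fun l => (X l : MvPolynomial σ ℝ)))
  convert! h using 1
  rw [hi, ← Finset.add_sum_erase _ _ hj]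
  ring

/-- The localizing inequality at `h² g i` reads `R² L(h²) ≥ ∑ L((h X l)²)`; the squares with `l ≠ j`
are dropped. -/
theorem IsPseudoMoment.rieszLinear_mul_sq_le {g : ι → MvPolynomial σ ℝ} {k : ℕ} {y : (σ →₀ ℕ) → ℝ}
    (hy : IsPseudoMoment g k y) {i : ι} {R : ℝ} {s : Finset σ} {j : σ} (hj : j ∈ s)
    (hi : g i = C (R ^ 2) - ∑ l ∈ s, X l ^ 2) {h : MvPolynomial σ ℝ} (hh : h.totalDegree + 1 ≤ k) :
    rieszLinear y (h * X j * (h * X j)) ≤ R ^ 2 * rieszLinear y (h * h) := by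
  classical
  rw [isPseudoMoment_iff] at hy
  obtain ⟨-, h1, h2⟩ := hy
  have hhalf : halfDegree (g i) ≤ 1 := by
    have : (g i).totalDegree ≤ 2 := by
      rw [hi]
      refine (totalDegree_sub _ _).trans (max_le (by rw [totalDegree_C]; lia) ?_)
      exact totalDegree_finsetSum_le fun l _ => (totalDegree_X_pow l 2).le
    rw [halfDegree]; lia
  have hloc := h2 i (by lia) h (by lia)
  have hsq : 0 ≤ ∑ l ∈ s.erase j, rieszLinear y (h * X l * (h * X l)) :=
    Finset.sum_nonneg fun l _ => h1 _ ((totalDegree_mul _ _).trans (by simpa using hh))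
  have e : h * h * g i = R ^ 2 • (h * h) - h * X j * (h * X j) -
      ∑ l ∈ s.erase j, h * X l * (h * X l) := by
    rw [hi, ← Finset.add_sum_erase _ _ hj, smul_eq_C_mul, mul_sub, mul_add, Finset.mul_sum,
      Finset.sum_congr rfl fun l _ => show h * h * X l ^ 2 = h * X l * (h * X l) by ring]
    ring
  rw [e, map_sub, map_sub, map_smul, smul_eq_mul, map_sum] at hloc
  linarith

/-- Stripping one variable at a time costs a factor `R j ^ 2 ≤ ρ` and bounds the diagonal moments;
positivity then bounds the others. Compactness thus only requires control of the mass `y 0`. -/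
theorem HasBallCover.exists_pseudoMoment_bound [Fintype σ] {g : ι → MvPolynomial σ ℝ}
    (hg : HasBallCover g) (k : ℕ) :
    ∃ B : ℝ, 0 ≤ B ∧ ∀ y, IsPseudoMoment g k y → 0 ≤ y 0 ∧ ∀ a, |y a| ≤ B * y 0 := by
  choose i R s hj hi using hg
  set ρ : ℝ := 1 + ∑ j, R j ^ 2 with hρ
  have hρ1 : 1 ≤ ρ := by
    have : 0 ≤ ∑ j, R j ^ 2 := Finset.sum_nonneg fun j _ => sq_nonneg _
    linarith
  have hR : ∀ j, R j ^ 2 ≤ ρ := fun j => by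
    have := Finset.single_le_sum (f := fun j => R j ^ 2) (fun j _ => sq_nonneg _)
      (Finset.mem_univ j)
    linarith
  refine ⟨ρ ^ k, by positivity, fun y hy => ?_⟩
  obtain ⟨hz, hsq, -⟩ := isPseudoMoment_iff.1 hy
  have hy0 : 0 ≤ y 0 := by
    have := hsq 1 (by simp)
    rwa [mul_one, rieszLinear_one] at this
  have hmon : ∀ a b : σ →₀ ℕ, rieszLinear y (monomial a 1 * monomial b 1) = y (a + b) := by
    intro a b
    rw [monomial_mul, rieszLinear_monomial]; simp
  have hdeg : ∀ a : σ →₀ ℕ, (monomial a (1 : ℝ)).totalDegree ≤ a.degree := fun a =>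
    totalDegree_monomial_le_degree a 1
  have hdiag : ∀ d, d ≤ k → ∀ a : σ →₀ ℕ, a.degree = d → y (a + a) ≤ ρ ^ d * y 0 := by
    intro d
    induction d with
    | zero =>
      intro _ a ha
      rw [Finsupp.degree_eq_zero_iff] at ha
      simp [ha]
    | succ d ih =>
      intro hd a ha
      have ha0 : a ≠ 0 := by rintro rfl; simp at ha
      obtain ⟨j, hj'⟩ := Finsupp.ne_iff.1 ha0
      have hle : Finsupp.single j 1 ≤ a := by
        rw [Finsupp.single_le_iff]
        exact Nat.one_le_iff_ne_zero.2 (by simpa using hj')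
      set b := a - Finsupp.single j 1 with hb
      have hab : b + Finsupp.single j 1 = a := tsub_add_cancel_of_le hle
      have hbd : b.degree = d := by
        have := congrArg Finsupp.degree hab
        rw [map_add, Finsupp.degree_single] at this
        lia
      have h1 := hy.rieszLinear_mul_sq_le (hj j) (hi j) (h := monomial b 1)
        (by have := hdeg b; lia)
      have e : monomial b (1 : ℝ) * X j = monomial a 1 := by
        rw [X, monomial_mul, hab, one_mul]
      rw [e, hmon, hmon] at h1
      have h2 := ih (by lia) b hbd
      have h3 : 0 ≤ y (b + b) := by
        rw [← hmon]; exact hsq _ ((hdeg b).trans (by lia))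
      calc y (a + a) ≤ R j ^ 2 * y (b + b) := h1
        _ ≤ ρ * (ρ ^ d * y 0) := mul_le_mul (hR j) h2 h3 (by positivity)
        _ = ρ ^ (d + 1) * y 0 := by ring
  have hdiag' : ∀ a : σ →₀ ℕ, a.degree ≤ k → y (a + a) ≤ ρ ^ k * y 0 := fun a ha =>
    (hdiag _ ha a rfl).trans (mul_le_mul_of_nonneg_right (pow_le_pow_right₀ hρ1 ha) hy0)
  have hmixed : ∀ a b : σ →₀ ℕ, a.degree ≤ k → b.degree ≤ k → |y (a + b)| ≤ ρ ^ k * y 0 := by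
    intro a b ha hb
    -- Testing on `xᵃ ± xᵇ` gives `2 |y (a + b)| ≤ y (2a) + y (2b)`.
    have h1 := hsq (monomial a 1 + monomial b 1)
      ((totalDegree_add _ _).trans (max_le ((hdeg a).trans ha) ((hdeg b).trans hb)))
    have h2 := hsq (monomial a 1 - monomial b 1)
      ((totalDegree_sub _ _).trans (max_le ((hdeg a).trans ha) ((hdeg b).trans hb)))
    simp only [add_mul, mul_add, sub_mul, mul_sub, map_add, map_sub, hmon] at h1 h2
    rw [add_comm b a] at h1 h2
    have h3 := hdiag' a ha
    have h4 := hdiag' b hb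
    rw [abs_le]
    constructor <;> linarith
  refine ⟨hy0, fun c => ?_⟩
  rcases le_or_gt c.degree (2 * k) with hc | hc
  · rcases le_or_gt c.degree k with hc' | hc'
    · simpa using hmixed c 0 hc' (by simp)
    · obtain ⟨a, hac, had⟩ := Finsupp.exists_le_degree_eq c k hc'.le
      have hsum : a + (c - a) = c := add_tsub_cancel_of_le hac
      have := congrArg Finsupp.degree hsum
      rw [map_add] at this
      rw [← hsum]
      exact hmixed a (c - a) had.le (by lia)
  · rw [hz c hc, abs_zero]; positivity

end Bounds

/-! ### The hierarchy for an abstract dynamics operator -/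

section Hierarchy

variable {n m nX nU : ℕ} {A : MvPolynomial (Fin n) ℝ →ₗ[ℝ] MvPolynomial (Fin n ⊕ Fin m) ℝ}
  {gX : Fin nX → MvPolynomial (Fin n) ℝ} {gU : Fin nU → MvPolynomial (Fin m) ℝ}

theorem setIntegral_eval_nonneg {p : MvPolynomial (Fin n) ℝ} (h : p ∈ quadraticModule gX) :
    0 ≤ ∫ x in semialgSet gX, eval x p :=
  setIntegral_nonneg (isClosed_semialgSet gX).measurableSet
    fun _ hx => eval_nonneg_of_mem_quadraticModule h hx

theorem dualApproximationValues_mono {k l r s : ℕ} (hkl : k ≤ l) (hrs : r ≤ s) :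
    dualApproximationValues A gX gU k r ⊆ dualApproximationValues A gX gU l s := by
  rintro c ⟨v, w, hv, hw, h1, h2, h3, rfl⟩
  exact ⟨v, w, by lia, by lia, h1.mono hrs, h2.mono hkl, h3.mono hkl, rfl⟩

theorem dualApproximationValues_nonempty (k r : ℕ) :
    (dualApproximationValues A gX gU k r).Nonempty := by
  refine ⟨_, 0, 1, by simp, by simp, ?_, ?_, ?_, rfl⟩
  · exact ⟨0, 0, .zero, by simp, fun i => ⟨.zero, by simp⟩, by simp⟩
  · exact ⟨0, 0, .zero, by simp, fun i => ⟨.zero, by simp⟩, by simp⟩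
  · exact ⟨1, 0, .one, by simp, fun i => ⟨.zero, by simp⟩, by simp⟩

theorem primalRelaxationValues_antitone {k l r s : ℕ} (hkl : k ≤ l) (hrs : r ≤ s) :
    primalRelaxationValues A gX gU l s ⊆ primalRelaxationValues A gX gU k r := by
  rintro c ⟨y, y₀, y₀', hy, hy₀, hy₀', h1, h2, rfl⟩
  refine ⟨_, _, _, hy.truncate hrs, hy₀.truncate hkl, hy₀'.truncate hkl, fun v hv hAv => ?_,
    fun w hw => ?_, ?_⟩
  · rw [← rieszLinear_apply, ← rieszLinear_apply, rieszLinear_truncatedMoments _ hAv,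
      rieszLinear_truncatedMoments _ hv, rieszLinear_apply, rieszLinear_apply]
    exact h1 v (by lia) (by lia)
  · rw [← rieszLinear_apply, ← rieszLinear_apply, rieszLinear_truncatedMoments _ hw,
      rieszLinear_truncatedMoments _ hw, rieszLinear_apply, rieszLinear_apply]
    exact h2 w (by lia)
  · simp [truncatedMoments, rieszLinear_one]

/-- A triple of functionals that are feasible on all polynomials yields a feasible point of every
relaxation. -/
theorem mem_primalRelaxationValues (hK : IsCompact (semialgSet gX))
    {L : MvPolynomial (Fin n ⊕ Fin m) ℝ →ₗ[ℝ] ℝ}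
    {L₀ L₀' : MvPolynomial (Fin n) ℝ →ₗ[ℝ] ℝ}
    (hL : ∀ p ∈ quadraticModule (productConstraints gX gU), 0 ≤ L p)
    (hL₀ : ∀ p ∈ quadraticModule gX, 0 ≤ L₀ p) (hL₀' : ∀ p ∈ quadraticModule gX, 0 ≤ L₀' p)
    (hA : ∀ v, L (A v) = L₀ v) (hsum : ∀ w, L₀ w + L₀' w = ∫ x in semialgSet gX, eval x w)
    (k r : ℕ) : L₀ 1 ∈ primalRelaxationValues A gX gU k r := by
  refine ⟨_, _, _, isPseudoMoment_truncatedMoments hL r, isPseudoMoment_truncatedMoments hL₀ k,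
    isPseudoMoment_truncatedMoments hL₀' k, fun v hv hAv => ?_, fun w hw => ?_, ?_⟩
  · rw [← rieszLinear_apply, ← rieszLinear_apply, rieszLinear_truncatedMoments _ hAv,
      rieszLinear_truncatedMoments _ hv, hA]
  · rw [← rieszLinear_apply, ← rieszLinear_apply, rieszLinear_truncatedMoments _ hw,
      rieszLinear_truncatedMoments _ hw, hsum, riesz_lebesgueMoment hK]
  · simp [truncatedMoments]

/-- The certificate of `A v` bounds its degree by `2 * r`, so the moment equation for this `v` is
among the constraints and gives `L_{y₀}(v) = L_y(A v) ≥ 0`. Then `(y₀)₀ ≤ L_{y₀}(w - v) ≤ L_{y₀}(w)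
≤ ∫ w`. -/
theorem primalRelaxationValues_le_dualApproximationValues {k r : ℕ} {p d : ℝ}
    (hp : p ∈ primalRelaxationValues A gX gU k r) (hd : d ∈ dualApproximationValues A gX gU k r) :
    p ≤ d := by
  obtain ⟨y, y₀, y₀', hy, hy₀, hy₀', h1, h2, rfl⟩ := hp
  obtain ⟨v, w, hv, hw, hAv, hwv, hw', rfl⟩ := hd
  have e1 := h1 v hv hAv.totalDegree_le
  have e2 := h2 w hw
  have i1 := hy.rieszLinear_nonneg hAv
  have i2 := hy₀.rieszLinear_nonneg hwv
  have i3 := hy₀'.rieszLinear_nonneg hw'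
  rw [map_sub, map_sub, rieszLinear_one] at i2
  rw [rieszLinear_apply] at i1 i3
  rw [rieszLinear_apply, rieszLinear_apply] at i2
  linarith

/-- Testing with `v = w = 1` gives `δ y_0 = (y₀)_0 ≤ λ(X)`, and likewise for `ŷ₀`. All masses, hence
all moments, are bounded, and the constraints are closed. -/
theorem isCompact_primalRelaxationValues (hX : HasBallConstraint gX) (hU : HasBallConstraint gU)
    {δ : ℝ} (hδ : 0 < δ) (hA : A 1 = C δ) (k r : ℕ) :
    IsCompact (primalRelaxationValues A gX gU k r) := by
  obtain ⟨B, hB0, hB⟩ := (hasBallCover_productConstraints hX hU).exists_pseudoMoment_bound r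
  obtain ⟨B₀, hB₀0, hB₀⟩ := hX.hasBallCover.exists_pseudoMoment_bound k
  set K := semialgSet gX
  set ℓ := riesz (lebesgueMoment K) 1 with hℓ
  set T : Set (((Fin n ⊕ Fin m →₀ ℕ) → ℝ) × ((Fin n →₀ ℕ) → ℝ) × ((Fin n →₀ ℕ) → ℝ)) :=
    {z | IsPseudoMoment (productConstraints gX gU) r z.1 ∧
      IsPseudoMoment gX k z.2.1 ∧ IsPseudoMoment gX k z.2.2 ∧
      (∀ v : MvPolynomial (Fin n) ℝ, v.totalDegree ≤ 2 * k → (A v).totalDegree ≤ 2 * r →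
        rieszLinear z.1 (A v) = rieszLinear z.2.1 v) ∧
      (∀ w : MvPolynomial (Fin n) ℝ, w.totalDegree ≤ 2 * k →
        rieszLinear z.2.1 w + rieszLinear z.2.2 w = riesz (lebesgueMoment K) w)} with hT
  have himage : primalRelaxationValues A gX gU k r = (fun z => z.2.1 0) '' T := by
    ext c
    simp only [primalRelaxationValues, hT, Set.mem_image, Set.mem_ofPred_eq, rieszLinear_apply]
    constructor
    · rintro ⟨y, y₀, y₀', h1, h2, h3, h4, h5, rfl⟩
      exact ⟨(y, y₀, y₀'), ⟨h1, h2, h3, h4, h5⟩, rfl⟩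
    · rintro ⟨⟨y, y₀, y₀'⟩, ⟨h1, h2, h3, h4, h5⟩, rfl⟩
      exact ⟨y, y₀, y₀', h1, h2, h3, h4, h5, rfl⟩
  rw [himage]
  refine IsCompact.image ?_ (by fun_prop)
  have hsub : T ⊆ (Set.univ.pi fun _ => Set.Icc (-(B * (ℓ / δ))) (B * (ℓ / δ))) ×ˢ
      (Set.univ.pi fun _ => Set.Icc (-(B₀ * ℓ)) (B₀ * ℓ)) ×ˢ
      (Set.univ.pi fun _ => Set.Icc (-(B₀ * ℓ)) (B₀ * ℓ)) := by
    rintro ⟨y, y₀, y₀'⟩ ⟨h1, h2, h3, h4, h5⟩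
    have e1 := h4 1 (by simp) (by simp [hA])
    have e2 := h5 1 (by simp)
    rw [hA, rieszLinear_C, rieszLinear_one] at e1
    rw [rieszLinear_one, rieszLinear_one, ← hℓ] at e2
    simp only at e1 e2 h1 h2 h3
    have p1 := hB y h1
    have p2 := hB₀ y₀ h2
    have p3 := hB₀ y₀' h3
    have b1 : y 0 ≤ ℓ / δ := by
      rw [le_div_iff₀ hδ]; linarith
    refine ⟨fun a _ => ?_, fun a _ => ?_, fun a _ => ?_⟩
    · exact abs_le.1 ((p1.2 a).trans (mul_le_mul_of_nonneg_left b1 hB0))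
    · exact abs_le.1 ((p2.2 a).trans (mul_le_mul_of_nonneg_left (by linarith) hB₀0))
    · exact abs_le.1 ((p3.2 a).trans (mul_le_mul_of_nonneg_left (by linarith) hB₀0))
  refine ((isCompact_univ_pi fun _ => isCompact_Icc).prod ((isCompact_univ_pi fun _ =>
    isCompact_Icc).prod (isCompact_univ_pi fun _ => isCompact_Icc))).of_isClosed_subset ?_ hsub
  simp only [hT, Set.ofPred_and, Set.ofPred_forall]
  refine IsClosed.inter ((isClosed_isPseudoMoment _ _).preimage continuous_fst) (IsClosed.inter
    ((isClosed_isPseudoMoment _ _).preimage (continuous_fst.comp continuous_snd)) (IsClosed.inter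
    ((isClosed_isPseudoMoment _ _).preimage (continuous_snd.comp continuous_snd))
    (IsClosed.inter ?_ ?_)))
  · exact isClosed_iInter fun v => isClosed_iInter fun _ => isClosed_iInter fun _ =>
      isClosed_eq ((continuous_rieszLinear _).comp continuous_fst)
        ((continuous_rieszLinear _).comp (continuous_fst.comp continuous_snd))
  · exact isClosed_iInter fun v => isClosed_iInter fun _ =>
      isClosed_eq (((continuous_rieszLinear _).comp (continuous_fst.comp continuous_snd)).add
        ((continuous_rieszLinear _).comp (continuous_snd.comp continuous_snd))) continuous_const

/-- Strong duality on the level of all polynomials: a lower bound `d ≥ 0` of the values of all dual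
approximations is attained by functionals that are feasible on all polynomials. -/
theorem exists_feasible_functionals (hX : HasBallConstraint gX) (hU : HasBallConstraint gU)
    {δ : ℝ} (hδ : 0 < δ) (hA : A 1 = C δ) {d : ℝ} (hd0 : 0 ≤ d)
    (hd : ∀ v w, A v ∈ quadraticModule (productConstraints gX gU) →
      w - v - 1 ∈ quadraticModule gX → w ∈ quadraticModule gX →
      d ≤ ∫ x in semialgSet gX, eval x w) :
    ∃ (L : MvPolynomial (Fin n ⊕ Fin m) ℝ →ₗ[ℝ] ℝ) (L₀ L₀' : MvPolynomial (Fin n) ℝ →ₗ[ℝ] ℝ),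
      (∀ p ∈ quadraticModule (productConstraints gX gU), 0 ≤ L p) ∧
      (∀ p ∈ quadraticModule gX, 0 ≤ L₀ p) ∧ (∀ p ∈ quadraticModule gX, 0 ≤ L₀' p) ∧
      (∀ v, L (A v) = L₀ v) ∧ (∀ w, L₀ w + L₀' w = ∫ x in semialgSet gX, eval x w) ∧
      L₀ 1 = d := by
  have hbX := hX.hasBallCover.boundsCoordinates
  have hbXU := (hasBallCover_productConstraints hX hU).boundsCoordinates
  have hK : IsCompact (semialgSet gX) := hbX.isCompact
  let s : PointedCone ℝ
      (MvPolynomial (Fin n ⊕ Fin m) ℝ × MvPolynomial (Fin n) ℝ × MvPolynomial (Fin n) ℝ) :=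
    (quadraticModule (productConstraints gX gU)).prod
      ((quadraticModule gX).prod (quadraticModule gX))
  let fstD : (MvPolynomial (Fin n) ℝ × MvPolynomial (Fin n) ℝ × ℝ) →ₗ[ℝ] MvPolynomial (Fin n) ℝ :=
    LinearMap.fst ℝ _ _
  let sndD : (MvPolynomial (Fin n) ℝ × MvPolynomial (Fin n) ℝ × ℝ) →ₗ[ℝ] MvPolynomial (Fin n) ℝ :=
    LinearMap.fst ℝ _ _ ∘ₗ LinearMap.snd ℝ _ _
  let thdD : (MvPolynomial (Fin n) ℝ × MvPolynomial (Fin n) ℝ × ℝ) →ₗ[ℝ] ℝ :=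
    LinearMap.snd ℝ _ _ ∘ₗ LinearMap.snd ℝ _ _
  -- The constant `1` in `w - v - 1` is homogenised to a variable `c`, so the claim `∫ w ≥ d`
  -- becomes positivity of the linear form `∫ w - d c`.
  let φ := (A ∘ₗ fstD).prod
    ((sndD - fstD - (Algebra.linearMap ℝ (MvPolynomial (Fin n) ℝ)) ∘ₗ thdD).prod sndD)
  let lam : MvPolynomial (Fin n) ℝ →ₗ[ℝ] ℝ := rieszLinear (lebesgueMoment (semialgSet gX))
  have hlam : ∀ w, lam w = ∫ x in semialgSet gX, eval x w := fun w => by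
    rw [← riesz_lebesgueMoment hK, ← rieszLinear_apply]
  let F := lam ∘ₗ sndD - d • thdD
  have hφ : ∀ v w c, φ (v, w, c) = (A v, w - v - C c, w) := fun v w c => rfl
  have hF : ∀ v w c, F (v, w, c) = lam w - d * c := fun v w c => rfl
  have hs : ∀ a b c, (a, b, c) ∈ s ↔ a ∈ quadraticModule (productConstraints gX gU) ∧
      b ∈ quadraticModule gX ∧ c ∈ quadraticModule gX := fun a b c => by
    simp [s, Submodule.mem_prod]
  obtain ⟨G, hG, hpos⟩ := exists_nonneg_extension s φ F
    (by
      rintro ⟨v, w, c⟩ h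
      rw [hφ, hs] at h
      obtain ⟨h1, h2, h3⟩ := h
      rw [hF, hlam]
      -- For `c ≤ 0` both terms are nonnegative, using `d ≥ 0`; for `c > 0` rescaling to `c = 1`
      -- gives a dual feasible pair.
      rcases le_or_gt c 0 with hc | hc
      · have := setIntegral_eval_nonneg h3
        nlinarith
      · have hc' : 0 ≤ c⁻¹ := (inv_pos.2 hc).le
        have key := hd (c⁻¹ • v) (c⁻¹ • w)
          (by rw [map_smul]; exact (quadraticModule _).smul_mem hc' h1)
          (by
            have := (quadraticModule _).smul_mem hc' h2
            rwa [smul_sub, smul_sub, smul_eq_C_mul (C c), ← map_mul, inv_mul_cancel₀ hc.ne', C_1]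
              at this)
          ((quadraticModule _).smul_mem hc' h3)
        rw [← hlam, map_smul, smul_eq_mul, hlam] at key
        have := mul_le_mul_of_nonneg_left key hc.le
        rw [mul_inv_cancel_left₀ hc.ne'] at this
        linarith)
    (by
      rintro ⟨a, b, c⟩
      obtain ⟨N₁, hN₁, -, h1⟩ := hbXU.exists_bound a
      obtain ⟨N₂, hN₂, -, h2⟩ := hbX.exists_bound b
      obtain ⟨N₃, hN₃, -, h3⟩ := hbX.exists_bound c
      -- Constants suffice: `v` makes `A v = N₁` dominate `a`, then `w` is taken large enough for
      -- both remaining components.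
      refine ⟨(C (N₁ / δ), C (N₁ / δ + N₂ + N₃), 0), ?_⟩
      have hAC : A (C (N₁ / δ)) = C N₁ := by
        rw [← mul_one (C (N₁ / δ)), ← smul_eq_C_mul, map_smul, hA, smul_eq_C_mul, ← map_mul,
          div_mul_cancel₀ _ hδ.ne']
      rw [hφ, Prod.mk_add_mk, Prod.mk_add_mk, hs, hAC]
      refine ⟨h1, ?_, ?_⟩
      · convert! add_mem h2 (C_mem_quadraticModule hN₃.le) using 1
        simp only [map_add, map_zero]; ring
      · convert! add_mem h3 (C_mem_quadraticModule (add_pos (div_pos hN₁ hδ) hN₂).le) using 1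
        simp only [map_add]; ring)
  refine ⟨G ∘ₗ LinearMap.inl ℝ _ _, G ∘ₗ LinearMap.inr ℝ _ _ ∘ₗ LinearMap.inl ℝ _ _,
    G ∘ₗ LinearMap.inr ℝ _ _ ∘ₗ LinearMap.inr ℝ _ _, fun p hp => ?_, fun p hp => ?_,
    fun p hp => ?_, fun v => ?_, fun w => ?_, ?_⟩
  · exact hpos _ ((hs _ _ _).2 ⟨hp, zero_mem _, zero_mem _⟩)
  · exact hpos _ ((hs _ _ _).2 ⟨zero_mem _, hp, zero_mem _⟩)
  · exact hpos _ ((hs _ _ _).2 ⟨zero_mem _, zero_mem _, hp⟩)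
  · have h := hG (v, 0, 0)
    rw [hφ, hF] at h
    simp only [map_zero, zero_sub, sub_zero, mul_zero] at h
    have e : (A v, -v, (0 : MvPolynomial (Fin n) ℝ)) = (A v, 0, 0) - (0, v, 0) := by simp
    rw [e, map_sub, sub_eq_zero] at h
    exact h
  · have h := hG (0, w, 0)
    rw [hφ, hF, hlam] at h
    simp only [map_zero, sub_zero, mul_zero] at h
    rw [← h]
    simp only [LinearMap.comp_apply, LinearMap.inr_apply, LinearMap.inl_apply]
    rw [← map_add]
    simp
  -- `(0, 0, -1)` is sent to `(0, 1, 0)`, while the form takes the value `d` there.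
  · have h := hG (0, 0, -1)
    rw [hφ, hF] at h
    simp only [map_zero, sub_zero, map_neg, zero_sub, neg_neg, mul_neg, mul_one, C_1] at h
    exact h

/-- Convergence of the hierarchy, given that polynomial certificates are feasible for the
infinite-dimensional dual problem, weak duality, and that functionals which are feasible on
polynomials are feasible for the infinite-dimensional primal problem. -/
theorem valuesConverge_of_polynomial_feasible (hX : HasBallConstraint gX)
    (hU : HasBallConstraint gU) {r : ℕ → ℕ} (hr : Monotone r) (hkr : ∀ k, k ≤ r k)
    {δ : ℝ} (hδ : 0 < δ) (hA : A 1 = C δ) {Dinf Pinf : Set ℝ}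
    (hD : ∀ v w, A v ∈ quadraticModule (productConstraints gX gU) →
      w - v - 1 ∈ quadraticModule gX → w ∈ quadraticModule gX →
      ∫ x in semialgSet gX, eval x w ∈ Dinf)
    (hweak : ∀ p ∈ Pinf, ∀ d ∈ Dinf, p ≤ d)
    (hP : ∀ (L : MvPolynomial (Fin n ⊕ Fin m) ℝ →ₗ[ℝ] ℝ)
      (L₀ L₀' : MvPolynomial (Fin n) ℝ →ₗ[ℝ] ℝ),
      (∀ p ∈ quadraticModule (productConstraints gX gU), 0 ≤ L p) →
      (∀ p ∈ quadraticModule gX, 0 ≤ L₀ p) → (∀ p ∈ quadraticModule gX, 0 ≤ L₀' p) →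
      (∀ v, L (A v) = L₀ v) → (∀ w, L₀ w + L₀' w = ∫ x in semialgSet gX, eval x w) →
      L₀ 1 ∈ Pinf) :
    ValuesConverge Dinf (fun k => dualApproximationValues A gX gU k (r k)) Pinf
      (fun k => primalRelaxationValues A gX gU k (r k)) := by
  have hK : IsCompact (semialgSet gX) := hX.hasBallCover.boundsCoordinates.isCompact
  set D : ℕ → Set ℝ := fun k => dualApproximationValues A gX gU k (r k) with hDdef
  set P : ℕ → Set ℝ := fun k => primalRelaxationValues A gX gU k (r k) with hPdef
  have hDmono : ∀ {k l}, k ≤ l → D k ⊆ D l := fun h => dualApproximationValues_mono h (hr h)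
  have hPanti : ∀ {k l}, k ≤ l → P l ⊆ P k := fun h => primalRelaxationValues_antitone h (hr h)
  have hDne : ∀ k, (D k).Nonempty := fun k => dualApproximationValues_nonempty k (r k)
  have hDval : ∀ k, ∀ c ∈ D k, ∃ v w, A v ∈ quadraticModule (productConstraints gX gU) ∧
      w - v - 1 ∈ quadraticModule gX ∧ w ∈ quadraticModule gX ∧
      c = ∫ x in semialgSet gX, eval x w := by
    rintro k c ⟨v, w, -, -, h1, h2, h3, rfl⟩
    exact ⟨v, w, h1.mem_quadraticModule, h2.mem_quadraticModule, h3.mem_quadraticModule,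
      riesz_lebesgueMoment hK w⟩
  have hDmem : ∀ v w, A v ∈ quadraticModule (productConstraints gX gU) →
      w - v - 1 ∈ quadraticModule gX → w ∈ quadraticModule gX →
      ∃ k, ∫ x in semialgSet gX, eval x w ∈ D k := by
    intro v w h1 h2 h3
    obtain ⟨k₁, h1⟩ := exists_inQuadraticModule h1
    obtain ⟨k₂, h2⟩ := exists_inQuadraticModule h2
    obtain ⟨k₃, h3⟩ := exists_inQuadraticModule h3
    -- One order exceeding every certificate and degree; `k ≤ r k` leaves room for the certificate
    -- on `X × U`.
    set k := k₁ + k₂ + k₃ + v.totalDegree + w.totalDegree with hk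
    have := hkr k
    exact ⟨k, v, w, by lia, by lia, h1.mono (by lia), h2.mono (by lia), h3.mono (by lia),
      (riesz_lebesgueMoment hK w).symm⟩
  have hDnonneg : ∀ k, ∀ c ∈ D k, 0 ≤ c := by
    intro k c hc
    obtain ⟨v, w, -, -, h3, rfl⟩ := hDval k c hc
    exact setIntegral_eval_nonneg h3
  have hUne : (⋃ k, D k).Nonempty := (hDne 0).mono (Set.subset_iUnion D 0)
  have hUbdd : BddBelow (⋃ k, D k) := ⟨0, fun c hc => by
    obtain ⟨k, hk⟩ := Set.mem_iUnion.1 hc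
    exact hDnonneg k c hk⟩
  set dinf := sInf (⋃ k, D k) with hdinf
  have hdinf_le : ∀ k, ∀ c ∈ D k, dinf ≤ c := fun k c hc =>
    csInf_le hUbdd (Set.mem_iUnion.2 ⟨k, hc⟩)
  have hdinf0 : 0 ≤ dinf := le_csInf hUne fun c hc => by
    obtain ⟨k, hk⟩ := Set.mem_iUnion.1 hc
    exact hDnonneg k c hk
  obtain ⟨L, L₀, L₀', hL, hL₀, hL₀', hLA, hsum, hval⟩ :=
    exists_feasible_functionals hX hU hδ hA hdinf0 (fun v w h1 h2 h3 => by
      obtain ⟨k, hk⟩ := hDmem v w h1 h2 h3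
      exact hdinf_le k _ hk)
  -- From here only order arguments remain: `dinf` is a primal value, a member of every `P k`, and
  -- the limit of the infima of `D k`.
  have hPinf : dinf ∈ Pinf := hval ▸ hP L L₀ L₀' hL hL₀ hL₀' hLA hsum
  have hDsub : ∀ k, D k ⊆ Dinf := by
    intro k c hc
    obtain ⟨v, w, h1, h2, h3, rfl⟩ := hDval k c hc
    exact hD v w h1 h2 h3
  have hPk : ∀ k, dinf ∈ P k := fun k =>
    hval ▸ mem_primalRelaxationValues hK hL hL₀ hL₀' hLA hsum k (r k)
  have hPgreat : ∀ k, ∃ p, IsGreatest (P k) p := fun k =>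
    (isCompact_primalRelaxationValues hX hU hδ hA k (r k)).exists_isGreatest ⟨_, hPk k⟩
  choose p hp using hPgreat
  have hDglb : ∀ k, IsGLB (D k) (sInf (D k)) := fun k =>
    isGLB_csInf (hDne k) ⟨0, fun c hc => hDnonneg k c hc⟩
  have hdlow : ∀ k, dinf ≤ sInf (D k) := fun k => le_csInf (hDne k) (hdinf_le k)
  have hdlim : Tendsto (fun k => sInf (D k)) atTop (𝓝 dinf) := by
    refine tendsto_order.2 ⟨fun a ha => .of_forall fun k => ha.trans_le (hdlow k), fun a ha => ?_⟩
    obtain ⟨c, hc, hca⟩ := exists_lt_of_csInf_lt hUne ha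
    obtain ⟨k₀, hk₀⟩ := Set.mem_iUnion.1 hc
    filter_upwards [eventually_ge_atTop k₀] with k hk
    exact ((hDglb k).1 (hDmono hk hk₀)).trans_lt hca
  refine ⟨⟨dinf, fun k => sInf (D k), ⟨fun d hd => hweak _ hPinf d hd, fun b hb => ?_⟩,
    fun k _ => hDglb k, fun k _ => ⟨hdlow _, ?_⟩, hdlim⟩,
    ⟨dinf, p, ⟨hPinf, fun q hq => ?_⟩, fun k _ => hp k, fun k _ => ⟨(hp _).2 (hPk _), ?_⟩, ?_⟩⟩
  · refine le_csInf hUne fun c hc => ?_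
    obtain ⟨k, hk⟩ := Set.mem_iUnion.1 hc
    exact hb (hDsub k hk)
  · exact (hDglb k).2 fun c hc => (hDglb (k + 1)).1 (hDmono (Nat.le_succ k) hc)
  · refine le_csInf hUne fun c hc => ?_
    obtain ⟨k, hk⟩ := Set.mem_iUnion.1 hc
    exact hweak q hq c (hDsub k hk)
  · exact (hp k).2 (hPanti (Nat.le_succ k) (hp (k + 1)).1)
  · exact tendsto_of_tendsto_of_tendsto_of_le_of_le tendsto_const_nhds hdlim
      (fun k => (hp k).2 (hPk k)) fun k => (hDglb k).2 fun c hc =>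
        primalRelaxationValues_le_dualApproximationValues (hp k).1 hc

end Hierarchy

/-! ### Polynomial approximation of continuously differentiable functions -/

section Approximation

variable {n : ℕ}

/-- The convolution of a compactly supported function with a polynomial is a polynomial. -/
theorem exists_polynomial_eq_convolution (q : MvPolynomial (Fin n) ℝ) :
    ∀ φ : (Fin n → ℝ) → ℝ, Continuous φ → HasCompactSupport φ →
      ∃ p : MvPolynomial (Fin n) ℝ, ∀ x, eval x p = ∫ y, φ y * eval (x - y) q := by
  have hint : ∀ (q : MvPolynomial (Fin n) ℝ) (φ : (Fin n → ℝ) → ℝ), Continuous φ →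
      HasCompactSupport φ → ∀ x, Integrable fun y => φ y * eval (x - y) q := by
    intro q φ hφ hs x
    have hc : Continuous fun y => eval (x - y) q := (continuous_eval q).comp (by fun_prop)
    exact (hφ.mul hc).integrable_of_hasCompactSupport hs.mul_right
  induction q using MvPolynomial.induction_on with
  | C a =>
    intro φ _ _
    exact ⟨C (∫ y, φ y * a), fun x => by simp⟩
  | add p q hp hq =>
    intro φ hφ hs
    obtain ⟨p', hp'⟩ := hp φ hφ hs
    obtain ⟨q', hq'⟩ := hq φ hφ hs
    refine ⟨p' + q', fun x => ?_⟩
    rw [map_add, hp', hq', ← integral_add (hint p φ hφ hs x) (hint q φ hφ hs x)]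
    simp only [map_add, mul_add]
  | mul_X q j hq =>
    intro φ hφ hs
    have hφ' : Continuous fun y => φ y * y j := hφ.mul (continuous_apply j)
    have hs' : HasCompactSupport fun y => φ y * y j := hs.mul_right
    obtain ⟨p₁, hp₁⟩ := hq φ hφ hs
    obtain ⟨p₂, hp₂⟩ := hq _ hφ' hs'
    -- The factor `x j - y j` splits, and `y j` is absorbed into `φ`; hence the induction runs over
    -- all `φ` simultaneously.
    refine ⟨X j * p₁ - p₂, fun x => ?_⟩
    rw [map_sub, map_mul, eval_X, hp₁, hp₂, ← integral_const_mul,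
      ← integral_sub ((hint q φ hφ hs x).const_mul _) (hint q _ hφ' hs' x)]
    refine integral_congr_ae (.of_forall fun y => ?_)
    simp only [map_mul, eval_X, Pi.sub_apply]
    ring

/-- A polynomial which on the box of radius `S` is positive and has a unique maximum at `0`. -/
def peakPolynomial (n : ℕ) (S : ℝ) : MvPolynomial (Fin n) ℝ :=
  C (n * S ^ 2 + 1) - ∑ i, X i ^ 2

theorem eval_peakPolynomial (S : ℝ) (t : Fin n → ℝ) :
    eval t (peakPolynomial n S) = n * S ^ 2 + 1 - ∑ i, t i ^ 2 := by
  simp [peakPolynomial]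

theorem eval_peakPolynomial_pos {S : ℝ} {t : Fin n → ℝ} (ht : t ∈ Metric.closedBall 0 S) :
    0 < eval t (peakPolynomial n S) := by
  rw [eval_peakPolynomial]
  have h : ∑ i, t i ^ 2 ≤ ∑ _i : Fin n, S ^ 2 := Finset.sum_le_sum fun i _ => by
    have h1 : ‖t i‖ ≤ S := (norm_le_pi_norm t i).trans (by simpa using ht)
    exact sq_le_sq' (by linarith [neg_abs_le (t i), Real.norm_eq_abs (t i)])
      ((le_abs_self _).trans h1)
  rw [Finset.sum_const, Finset.card_univ, Fintype.card_fin, nsmul_eq_mul] at h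
  linarith

variable {E : Type*} [NormedAddCommGroup E] [NormedSpace ℝ E]

/-- The average of `φ` around `x` with weights given by the `k`-th power of the peak polynomial. -/
def peakAverage (S : ℝ) (k : ℕ) (φ : (Fin n → ℝ) → E) (x : Fin n → ℝ) : E :=
  (∫ t in Metric.closedBall 0 S, eval t (peakPolynomial n S) ^ k)⁻¹ •
    ∫ t, eval t (peakPolynomial n S) ^ k • φ (x - t)

/-- If `φ (x - t) ≠ 0` then `‖t‖ ≤ ‖x‖ + a ≤ S`. The integral over the whole space serves for
polynomiality and differentiation, the one over the ball, where the weight is positive, for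
convergence and bounds. -/
theorem peakAverage_eq {S a : ℝ} {φ : (Fin n → ℝ) → E}
    (hφ : ∀ y, a < ‖y‖ → φ y = 0) {x : Fin n → ℝ} (hx : ‖x‖ + a ≤ S) (k : ℕ) :
    peakAverage S k φ x = (∫ t in Metric.closedBall 0 S, eval t (peakPolynomial n S) ^ k)⁻¹ •
      ∫ t in Metric.closedBall 0 S, eval t (peakPolynomial n S) ^ k • φ (x - t) := by
  rw [peakAverage]
  congr 1
  refine (setIntegral_eq_integral_of_forall_compl_eq_zero fun t ht => ?_).symm
  rw [mem_closedBall_zero_iff, not_le] at ht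
  rw [hφ _ (by have := norm_sub_norm_le t x; rw [norm_sub_rev] at this; linarith), smul_zero]

theorem tendsto_peakAverage [CompleteSpace E] {S a : ℝ} (hS : 0 < S) {φ : (Fin n → ℝ) → E}
    (hc : Continuous φ) (hφ : ∀ y, a < ‖y‖ → φ y = 0) {x : Fin n → ℝ} (hx : ‖x‖ + a ≤ S) :
    Tendsto (fun k => peakAverage S k φ x) atTop (𝓝 (φ x)) := by
  simp only [peakAverage_eq hφ hx]
  have h := tendsto_setIntegral_pow_smul_of_unique_maximum_of_isCompact_of_continuousOn
    (μ := (volume : Measure (Fin n → ℝ))) (g := fun t => φ (x - t)) (x₀ := 0)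
    (isCompact_closedBall (0 : Fin n → ℝ) S)
    (continuous_eval (peakPolynomial n S)).continuousOn
    (fun t _ ht0 => by
      rw [eval_peakPolynomial, eval_peakPolynomial]
      obtain ⟨i, hi⟩ := Function.ne_iff.1 ht0
      have : 0 < ∑ i, t i ^ 2 := Finset.sum_pos' (fun i _ => sq_nonneg _)
        ⟨i, Finset.mem_univ i, by
          have hi' : t i ≠ 0 := hi
          positivity⟩
      simpa using this)
    (fun t ht => (eval_peakPolynomial_pos ht).le)
    (eval_peakPolynomial_pos (by simpa using hS.le))
    (subset_closure (mem_interior_iff_mem_nhds.2 (Metric.closedBall_mem_nhds _ hS)))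
    (hc.comp (continuous_const.sub continuous_id)).continuousOn
  simpa using h

theorem norm_peakAverage_le {S a B : ℝ} {φ : (Fin n → ℝ) → E} (hB : ∀ y, ‖φ y‖ ≤ B)
    (hφ : ∀ y, a < ‖y‖ → φ y = 0) {x : Fin n → ℝ} (hx : ‖x‖ + a ≤ S) (k : ℕ) :
    ‖peakAverage S k φ x‖ ≤ B := by
  have hB0 : 0 ≤ B := (norm_nonneg _).trans (hB 0)
  rw [peakAverage_eq hφ hx]
  set s := Metric.closedBall (0 : Fin n → ℝ) S
  set c : (Fin n → ℝ) → ℝ := fun t => eval t (peakPolynomial n S) ^ k with hc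
  have hms : MeasurableSet s := Metric.isClosed_closedBall.measurableSet
  have hci : IntegrableOn c s := (((continuous_eval _).pow k).continuousOn).integrableOn_compact
    (isCompact_closedBall _ _)
  have hc0 : ∀ t ∈ s, 0 ≤ c t := fun t ht => pow_nonneg (eval_peakPolynomial_pos ht).le k
  have hI0 : 0 ≤ ∫ t in s, c t := setIntegral_nonneg hms hc0
  have h1 : ‖∫ t in s, c t • φ (x - t)‖ ≤ ∫ t in s, c t * B := by
    refine norm_integral_le_of_norm_le (hci.mul_const B) ?_
    filter_upwards [ae_restrict_mem hms] with t ht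
    rw [norm_smul, Real.norm_of_nonneg (hc0 t ht)]
    exact mul_le_mul_of_nonneg_left (hB _) (hc0 t ht)
  rw [integral_mul_const] at h1
  rw [norm_smul, norm_inv, Real.norm_of_nonneg hI0]
  calc (∫ t in s, c t)⁻¹ * ‖∫ t in s, c t • φ (x - t)‖
      ≤ (∫ t in s, c t)⁻¹ * ((∫ t in s, c t) * B) :=
        mul_le_mul_of_nonneg_left h1 (inv_nonneg.2 hI0)
    _ ≤ B := by
        -- As `S` may be degenerate, the normalising integral can vanish; its inverse is then `0`
        -- and the bound is trivial.
        rcases hI0.eq_or_lt with h | h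
        · rw [← h]; simpa using hB0
        · rw [inv_mul_cancel_left₀ h.ne']

theorem exists_polynomial_eq_peakAverage (S : ℝ) (k : ℕ) {φ : (Fin n → ℝ) → ℝ}
    (hc : Continuous φ) (hs : HasCompactSupport φ) :
    ∃ p : MvPolynomial (Fin n) ℝ, ∀ x, eval x p = peakAverage S k φ x := by
  obtain ⟨p, hp⟩ := exists_polynomial_eq_convolution (peakPolynomial n S ^ k) φ hc hs
  refine ⟨C (∫ t in Metric.closedBall 0 S, eval t (peakPolynomial n S) ^ k)⁻¹ * p, fun x => ?_⟩
  rw [map_mul, eval_C, hp, peakAverage, smul_eq_mul, ← integral_sub_left_eq_self _ volume x]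
  simp only [sub_sub_cancel, map_pow, smul_eq_mul, mul_comm]

/-- The derivative of a convolution falls on the smooth factor, so the derivative of the average is
the average of the derivative. Applying the vector-valued convergence to `fderiv ℝ φ` then gives
`C¹` approximation. -/
theorem hasFDerivAt_peakAverage (S : ℝ) (k : ℕ) {φ : (Fin n → ℝ) → ℝ}
    (hc : ContDiff ℝ 1 φ) (hs : HasCompactSupport φ) (x : Fin n → ℝ) :
    HasFDerivAt (peakAverage S k φ) (peakAverage S k (fderiv ℝ φ) x) x := by
  have hloc : LocallyIntegrable (fun t : Fin n → ℝ => eval t (peakPolynomial n S) ^ k) volume :=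
    ((continuous_eval _).pow k).locallyIntegrable
  have h := (hs.hasFDerivAt_convolution_left (ContinuousLinearMap.lsmul ℝ ℝ) hc hloc x).const_smul
    (∫ t in Metric.closedBall 0 S, eval t (peakPolynomial n S) ^ k)⁻¹
  convert! h using 1
  · funext y
    rw [Pi.smul_apply, convolution_lsmul_swap, peakAverage]
    simp only [smul_eq_mul, mul_comm]
  · rw [convolution_eq_swap, peakAverage]
    congr 2
    funext t
    ext h
    simp [mul_comm]

/-- A continuously differentiable function is a pointwise limit of polynomials on a compact set,
together with its derivative and with uniform bounds. -/
theorem exists_polynomial_tendsto_fderiv {v : (Fin n → ℝ) → ℝ} (hv : ContDiff ℝ 1 v)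
    {K : Set (Fin n → ℝ)} (hK : IsCompact K) :
    ∃ (p : ℕ → MvPolynomial (Fin n) ℝ) (B : ℝ), ∀ x ∈ K,
      Tendsto (fun k => eval x (p k)) atTop (𝓝 (v x)) ∧
      Tendsto (fun k => fderiv ℝ (fun z => eval z (p k)) x) atTop (𝓝 (fderiv ℝ v x)) ∧
      ∀ k, ‖eval x (p k)‖ ≤ B ∧ ‖fderiv ℝ (fun z => eval z (p k)) x‖ ≤ B := by
  obtain ⟨ρ, hρ0, hρ⟩ := hK.isBounded.exists_pos_norm_le
  -- The cutoff is `1` near every point of `K`, so neither the values nor the derivatives of `v`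
  -- change there.
  let χ : ContDiffBump (0 : Fin n → ℝ) := ⟨ρ + 1, ρ + 2, by linarith, by linarith⟩
  set φ : (Fin n → ℝ) → ℝ := fun x => χ x * v x with hφdef
  have hφ : ContDiff ℝ 1 φ := χ.contDiff.mul hv
  have hφs : HasCompactSupport φ := χ.hasCompactSupport.mul_right
  have hφ' : Continuous (fderiv ℝ φ) := hφ.continuous_fderiv one_ne_zero
  have hφs' : HasCompactSupport (fderiv ℝ φ) := hφs.fderiv ℝ
  have hsupp : tsupport φ ⊆ Metric.closedBall 0 (ρ + 2) :=
    (tsupport_mul_subset_left (f := χ) (g := v)).trans χ.tsupport_eq.le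
  have hzero : ∀ y, ρ + 2 < ‖y‖ → φ y = 0 := fun y hy =>
    image_eq_zero_of_notMem_tsupport fun h => by
      have := hsupp h
      rw [mem_closedBall_zero_iff] at this
      linarith
  have hzero' : ∀ y, ρ + 2 < ‖y‖ → fderiv ℝ φ y = 0 := fun y hy =>
    image_eq_zero_of_notMem_tsupport fun h => by
      have := hsupp (tsupport_fderiv_subset ℝ h)
      rw [mem_closedBall_zero_iff] at this
      linarith
  obtain ⟨B₁, hB₁⟩ := hφs.exists_bound_of_continuous hφ.continuous
  obtain ⟨B₂, hB₂⟩ := hφs'.exists_bound_of_continuous hφ'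
  -- `S = ρ + (ρ + 2)`: the bound for `K` plus the radius of the support of `φ`.
  set S := 2 * ρ + 2 with hS
  have hS0 : 0 < S := by linarith
  choose p hp using fun k => exists_polynomial_eq_peakAverage S k hφ.continuous hφs
  have hpf : ∀ k, (fun z => eval z (p k)) = peakAverage S k φ := fun k => funext (hp k)
  refine ⟨p, max B₁ B₂, fun x hx => ?_⟩
  have hxρ : ‖x‖ ≤ ρ := hρ x hx
  have hxS : ‖x‖ + (ρ + 2) ≤ S := by linarith
  have heq : φ =ᶠ[𝓝 x] v := by
    have : x ∈ Metric.ball (0 : Fin n → ℝ) χ.rIn := by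
      rw [mem_ball_zero_iff]; change ‖x‖ < ρ + 1; linarith
    filter_upwards [χ.eventuallyEq_one_of_mem_ball this] with y hy
    simp [hφdef, hy]
  have hfd : ∀ k, fderiv ℝ (fun z => eval z (p k)) x = peakAverage S k (fderiv ℝ φ) x := fun k => by
    rw [hpf]
    exact (hasFDerivAt_peakAverage S k hφ hφs x).fderiv
  refine ⟨?_, ?_, fun k => ⟨?_, ?_⟩⟩
  · simp only [hp, ← heq.eq_of_nhds]
    exact tendsto_peakAverage hS0 hφ.continuous hzero hxS
  · simp only [hfd, ← heq.fderiv_eq]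
    exact tendsto_peakAverage hS0 hφ' hzero' hxS
  · rw [hp]
    exact (norm_peakAverage_le hB₁ hzero hxS k).trans (le_max_left _ _)
  · rw [hfd]
    exact (norm_peakAverage_le hB₂ hzero' hxS k).trans (le_max_right _ _)

end Approximation

/-! ### Measures supported in compact sets -/

section Measures

variable {Z : Type*} [TopologicalSpace Z] [MeasurableSpace Z] [BorelSpace Z] [T2Space Z]
  {μ : Measure Z} [IsFiniteMeasure μ] {K : Set Z}

theorem integrable_of_continuousOn_compact (hK : IsCompact K) (hμ : ∀ᵐ z ∂μ, z ∈ K) {w : Z → ℝ}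
    (hw : ContinuousOn w K) : Integrable w μ := by
  rw [← Measure.restrict_eq_self_of_ae_mem hμ]
  exact hw.integrableOn_compact' hK hK.measurableSet

end Measures

/-! ### Integrals and derivatives of polynomials -/

section Polynomials

/-- Integrals of uniform polynomial approximations converge. -/
theorem tendsto_integral_eval {n : ℕ} {μ : Measure (Fin n → ℝ)} [IsFiniteMeasure μ]
    {K : Set (Fin n → ℝ)} (hK : IsCompact K) (hμ : ∀ᵐ x ∂μ, x ∈ K) {w : (Fin n → ℝ) → ℝ}
    (hw : ContinuousOn w K) {p : ℕ → MvPolynomial (Fin n) ℝ}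
    (hp : ∀ k, ∀ x ∈ K, |eval x (p k) - w x| < 1 / ((k : ℝ) + 1)) :
    Tendsto (fun k => ∫ x, eval x (p k) ∂μ) atTop (𝓝 (∫ x, w x ∂μ)) := by
  refine tendsto_integral_of_dominated_convergence (fun x => |w x| + 1)
    (fun k => (continuous_eval _).aestronglyMeasurable)
    ((integrable_of_continuousOn_compact hK hμ hw).abs.add (integrable_const _)) (fun k => ?_) ?_
  · filter_upwards [hμ] with x hx
    have h1 := hp k x hx
    have h2 : 1 / ((k : ℝ) + 1) ≤ 1 := by
      rw [div_le_one (by positivity)]; linarith [Nat.cast_nonneg (α := ℝ) k]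
    have h3 := abs_sub_abs_le_abs_sub (eval x (p k)) (w x)
    rw [Real.norm_eq_abs]
    linarith
  · filter_upwards [hμ] with x hx
    rw [tendsto_iff_norm_sub_tendsto_zero]
    exact squeeze_zero (fun _ => norm_nonneg _) (fun k => (hp k x hx).le)
      tendsto_one_div_add_atTop_nhds_zero_nat

theorem hasFDerivAt_eval {n : ℕ} (p : MvPolynomial (Fin n) ℝ) (x : Fin n → ℝ) :
    HasFDerivAt (fun z => eval z p)
      (∑ i, eval x (pderiv i p) • ContinuousLinearMap.proj (R := ℝ) (φ := fun _ : Fin n => ℝ) i)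
      x := by
  induction p using MvPolynomial.induction_on with
  | C a => simpa using hasFDerivAt_const a x
  | add p q hp hq =>
    simp only [map_add, add_smul, Finset.sum_add_distrib]
    exact hp.add hq
  | mul_X p j hp =>
    have hj : HasFDerivAt (fun z : Fin n → ℝ => z j)
        (ContinuousLinearMap.proj (R := ℝ) (φ := fun _ : Fin n => ℝ) j) x :=
      (ContinuousLinearMap.proj (R := ℝ) (φ := fun _ : Fin n => ℝ) j).hasFDerivAt
    have h := hp.mul hj
    simp only [map_mul, eval_X]
    convert! h using 1
    ext t
    simp only [Derivation.leibniz, smul_eq_mul, map_add, map_mul, eval_X, pderiv_X, add_smul,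
      Finset.sum_add_distrib, add_apply, sum_apply,
      smul_apply, ContinuousLinearMap.proj_apply, Finset.mul_sum]
    congr 1
    · rw [Finset.sum_eq_single j (by intro i _ hi; simp [hi.symm]) (by simp)]
      simp
    · exact Finset.sum_congr rfl fun i _ => by ring

theorem fderiv_eval_apply {n : ℕ} (p : MvPolynomial (Fin n) ℝ) (x h : Fin n → ℝ) :
    fderiv ℝ (fun z => eval z p) x h = ∑ i, eval x (pderiv i p) * h i := by
  rw [(hasFDerivAt_eval p x).fderiv]
  simp

theorem contDiff_eval {n : ℕ} (p : MvPolynomial (Fin n) ℝ) :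
    ContDiff ℝ 1 (fun z : Fin n → ℝ => eval z p) :=
  contDiffOn_univ.1 ((AnalyticOnNhd.eval_mvPolynomial p).contDiffOn uniqueDiffOn_univ)

end Polynomials

/-! ### The infinite-dimensional linear programs -/

section Programs

variable {n m nX nU : ℕ} {f : Fin n → MvPolynomial (Fin n ⊕ Fin m) ℝ}
  {gX : Fin nX → MvPolynomial (Fin n) ℝ} {gU : Fin nU → MvPolynomial (Fin m) ℝ}

theorem continuous_sumElim :
    Continuous fun z : (Fin n → ℝ) × (Fin m → ℝ) => (Sum.elim z.1 z.2 : Fin n ⊕ Fin m → ℝ) := by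
  refine continuous_pi fun j => ?_
  rcases j with j | j
  · exact (continuous_apply j).comp continuous_fst
  · exact (continuous_apply j).comp continuous_snd

theorem continuous_evalField :
    Continuous fun z : (Fin n → ℝ) × (Fin m → ℝ) => evalField f z.1 z.2 :=
  continuous_pi fun i => (continuous_eval (f i)).comp continuous_sumElim

theorem mem_semialgSet_productConstraints {z : Fin n ⊕ Fin m → ℝ} :
    z ∈ semialgSet (productConstraints gX gU) ↔
      z ∘ Sum.inl ∈ semialgSet gX ∧ z ∘ Sum.inr ∈ semialgSet gU := by
  simp [semialgSet, productConstraints, Sum.forall, eval_rename]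

/-- Weak duality apart from the dynamics: `μ₀(K) ≤ ∫ (w - v) dμ₀ ≤ ∫ w dμ₀ ≤ ∫_K w`. The dynamics
enter only through `∫ v dμ₀ ≥ 0`, so both time settings share this step. -/
theorem LebesgueSplit.measureReal_le {K : Set (Fin n → ℝ)} (hK : IsCompact K)
    {μ₀ μ₀' : Measure (Fin n → ℝ)} (h : LebesgueSplit K μ₀ μ₀') {v w : (Fin n → ℝ) → ℝ}
    (hv : ContinuousOn v K) (hw : ContinuousOn w K) (hvw : ∀ x ∈ K, v x + 1 ≤ w x)
    (hw0 : ∀ x ∈ K, 0 ≤ w x) (hpos : 0 ≤ ∫ x, v x ∂μ₀) : μ₀.real K ≤ ∫ x in K, w x := by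
  obtain ⟨h1, h2, h3, h4, hint⟩ := h
  have ae : ∀ᵐ x ∂μ₀, x ∈ K := mem_of_superset Measure.support_mem_ae h3
  have ae' : ∀ᵐ x ∂μ₀', x ∈ K := mem_of_superset Measure.support_mem_ae h4
  have iv := integrable_of_continuousOn_compact hK ae hv
  have iw := integrable_of_continuousOn_compact hK ae hw
  have e1 : ∫ x, (v x + 1) ∂μ₀ ≤ ∫ x, w x ∂μ₀ :=
    integral_mono_ae (iv.add (integrable_const _)) iw (ae.mono fun x hx => hvw x hx)
  rw [integral_add iv (integrable_const _), integral_const, smul_eq_mul, mul_one] at e1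
  have e2 : 0 ≤ ∫ x, w x ∂μ₀' := integral_nonneg_of_ae (ae'.mono fun x hx => hw0 x hx)
  have e3 : μ₀.real K ≤ μ₀.real Set.univ := measureReal_mono (Set.subset_univ _)
  rw [← hint w hw]
  linarith

/-- Functionals that are nonnegative on the quadratic modules are given by measures. -/
theorem exists_measures_of_functionals (hX : HasBallConstraint gX) (hU : HasBallConstraint gU)
    {L : MvPolynomial (Fin n ⊕ Fin m) ℝ →ₗ[ℝ] ℝ}
    {L₀ L₀' : MvPolynomial (Fin n) ℝ →ₗ[ℝ] ℝ}
    (hL : ∀ p ∈ quadraticModule (productConstraints gX gU), 0 ≤ L p)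
    (hL₀ : ∀ p ∈ quadraticModule gX, 0 ≤ L₀ p) (hL₀' : ∀ p ∈ quadraticModule gX, 0 ≤ L₀' p)
    (hsum : ∀ w, L₀ w + L₀' w = ∫ x in semialgSet gX, eval x w) :
    ∃ (μ : Measure ((Fin n → ℝ) × (Fin m → ℝ))) (μ₀ μ₀' : Measure (Fin n → ℝ)),
      IsFiniteMeasure μ ∧ μ.support ⊆ semialgSet gX ×ˢ semialgSet gU ∧
      LebesgueSplit (semialgSet gX) μ₀ μ₀' ∧
      (∀ p, L p = ∫ z, eval (Sum.elim z.1 z.2) p ∂μ) ∧ (∀ p, L₀ p = ∫ x, eval x p ∂μ₀) ∧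
      L₀ 1 = μ₀.real (semialgSet gX) := by
  have hbX := hX.hasBallCover.boundsCoordinates
  have hK : IsCompact (semialgSet gX) := hbX.isCompact
  have hKU : IsCompact (semialgSet gU) := hU.hasBallCover.boundsCoordinates.isCompact
  obtain ⟨ν, hν, hν0, hνL⟩ :=
    (hasBallCover_productConstraints hX hU).boundsCoordinates.exists_measure L hL
  obtain ⟨μ₀, hμ₀, hμ₀0, hμ₀L⟩ := hbX.exists_measure L₀ hL₀
  obtain ⟨μ₀', hμ₀', hμ₀'0, hμ₀'L⟩ := hbX.exists_measure L₀' hL₀'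
  let T : (Fin n ⊕ Fin m → ℝ) → (Fin n → ℝ) × (Fin m → ℝ) :=
    fun z => (z ∘ Sum.inl, z ∘ Sum.inr)
  have hT : Continuous T := by
    refine Continuous.prodMk ?_ ?_ <;> exact continuous_pi fun i => continuous_apply _
  refine ⟨ν.map T, μ₀, μ₀', inferInstance, ?_, ⟨hμ₀, hμ₀', ?_, ?_, fun w hw => ?_⟩, fun p => ?_,
    hμ₀L, ?_⟩
  · refine Measure.support_subset_of_isClosed (hK.isClosed.prod hKU.isClosed) ?_
    rw [mem_ae_iff, Measure.map_apply hT.measurable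
      (hK.isClosed.prod hKU.isClosed).measurableSet.compl]
    refine measure_mono_null (fun z hz => ?_) hν0
    intro h
    exact hz (mem_semialgSet_productConstraints.1 h)
  · exact Measure.support_subset_of_isClosed hK.isClosed hμ₀0
  · exact Measure.support_subset_of_isClosed hK.isClosed hμ₀'0
  -- The splitting of Lebesgue measure is known on polynomials; uniform approximation on `X` carries
  -- it to `C(X)`.
  · choose p hp using fun k : ℕ =>
      exists_polynomial_near hK hw (ε := 1 / ((k : ℝ) + 1)) (by positivity)
    have : IsFiniteMeasure (volume.restrict (semialgSet gX)) :=
      ⟨by simpa using hK.measure_lt_top⟩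
    have t1 := (tendsto_integral_eval hK hμ₀0 hw hp).add (tendsto_integral_eval hK hμ₀'0 hw hp)
    have t2 := tendsto_integral_eval (μ := volume.restrict (semialgSet gX)) hK
      (ae_restrict_mem hK.measurableSet) hw hp
    simp only [← hμ₀L, ← hμ₀'L, hsum] at t1
    exact tendsto_nhds_unique t1 t2
  · have hc : Continuous fun z : (Fin n → ℝ) × (Fin m → ℝ) => eval (Sum.elim z.1 z.2) p :=
      (continuous_eval p).comp continuous_sumElim
    rw [integral_map hT.measurable.aemeasurable hc.aestronglyMeasurable, hνL]
    simp [T]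
  · rw [hμ₀L]
    have hK1 : μ₀.restrict (semialgSet gX) = μ₀ := Measure.restrict_eq_self_of_ae_mem hμ₀0
    conv_lhs => rw [← hK1]
    simp

theorem eval_discreteOp (α : ℝ) (v : MvPolynomial (Fin n) ℝ) (x : Fin n → ℝ) (u : Fin m → ℝ) :
    eval (Sum.elim x u) (discreteOp f α v) = eval x v - α * eval (evalField f x u) v := by
  have h : eval (Sum.elim x u) (bind₁ f v) = eval (evalField f x u) v := by
    induction v using MvPolynomial.induction_on with
    | C a => simp
    | add p q hp hq => simp [hp, hq]
    | mul_X p j hp => simp [hp, evalField]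
  simp [discreteOp, h, eval_rename]

theorem eval_continuousOp (β : ℝ) (v : MvPolynomial (Fin n) ℝ) (x : Fin n → ℝ) (u : Fin m → ℝ) :
    eval (Sum.elim x u) (continuousOp f β v) =
      β * eval x v - fderiv ℝ (fun z => eval z v) x (evalField f x u) := by
  simp [continuousOp, fderiv_eval_apply, eval_rename, evalField]

/-- `discreteOp` as a linear map. -/
def discreteOpLinear (f : Fin n → MvPolynomial (Fin n ⊕ Fin m) ℝ) (α : ℝ) :
    MvPolynomial (Fin n) ℝ →ₗ[ℝ] MvPolynomial (Fin n ⊕ Fin m) ℝ where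
  toFun := discreteOp f α
  map_add' v w := by simp only [discreteOp, map_add]; ring
  map_smul' c v := by
    simp only [discreteOp, smul_eq_C_mul, map_mul, rename_C, bind₁_C_right, RingHom.id_apply]; ring

/-- `continuousOp` as a linear map. -/
def continuousOpLinear (f : Fin n → MvPolynomial (Fin n ⊕ Fin m) ℝ) (β : ℝ) :
    MvPolynomial (Fin n) ℝ →ₗ[ℝ] MvPolynomial (Fin n ⊕ Fin m) ℝ where
  toFun := continuousOp f β
  map_add' v w := by
    simp only [continuousOp, map_add, add_mul, Finset.sum_add_distrib]; ring
  map_smul' c v := by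
    simp only [continuousOp, smul_eq_C_mul, map_mul, rename_C, pderiv_C_mul, RingHom.id_apply,
      mul_assoc, ← Finset.mul_sum]
    ring

theorem discreteDual_of_polynomials {α : ℝ} {v w : MvPolynomial (Fin n) ℝ}
    (h1 : discreteOp f α v ∈ quadraticModule (productConstraints gX gU))
    (h2 : w - v - 1 ∈ quadraticModule gX) (h3 : w ∈ quadraticModule gX) :
    ∫ x in semialgSet gX, eval x w ∈
      discreteDualValues f (semialgSet gX) (semialgSet gU) α := by
  refine ⟨fun x => eval x v, fun x => eval x w, continuous_eval v, (continuous_eval w).continuousOn,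
    fun x hx u hu => ?_, fun x hx => ?_, fun x hx => eval_nonneg_of_mem_quadraticModule h3 hx, rfl⟩
  · have h := eval_nonneg_of_mem_quadraticModule h1 (z := Sum.elim x u)
      (mem_semialgSet_productConstraints.2 ⟨hx, hu⟩)
    rw [eval_discreteOp] at h
    linarith
  · have h := eval_nonneg_of_mem_quadraticModule h2 hx
    simp only [map_sub, map_one] at h
    linarith

theorem continuousDual_of_polynomials {β : ℝ} {v w : MvPolynomial (Fin n) ℝ}
    (h1 : continuousOp f β v ∈ quadraticModule (productConstraints gX gU))
    (h2 : w - v - 1 ∈ quadraticModule gX) (h3 : w ∈ quadraticModule gX) :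
    ∫ x in semialgSet gX, eval x w ∈
      continuousDualValues f (semialgSet gX) (semialgSet gU) β := by
  refine ⟨fun x => eval x v, fun x => eval x w, contDiff_eval v, (continuous_eval w).continuousOn,
    fun x hx u hu => ?_, fun x hx => ?_, fun x hx => eval_nonneg_of_mem_quadraticModule h3 hx, rfl⟩
  · have h := eval_nonneg_of_mem_quadraticModule h1 (z := Sum.elim x u)
      (mem_semialgSet_productConstraints.2 ⟨hx, hu⟩)
    rw [eval_continuousOp] at h
    linarith
  · have h := eval_nonneg_of_mem_quadraticModule h2 hx
    simp only [map_sub, map_one] at h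
    linarith

/-- Integrating `A v ≥ 0` against `μ` and using the dynamics constraint gives `∫ v dμ₀ ≥ 0`. -/
theorem discrete_weak_duality {K : Set (Fin n → ℝ)} {U : Set (Fin m → ℝ)} (hK : IsCompact K)
    (hU : IsCompact U) {α p d : ℝ} (hp : p ∈ discretePrimalValues f K U α)
    (hd : d ∈ discreteDualValues f K U α) : p ≤ d := by
  obtain ⟨μ, μ₀, μ₀', hμ, hsupp, hsplit, hdyn, rfl⟩ := hp
  obtain ⟨v, w, hv, hw, h1, h2, h3, rfl⟩ := hd
  refine hsplit.measureReal_le hK hv.continuousOn hw h2 h3 ?_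
  have ae : ∀ᵐ z ∂μ, z ∈ K ×ˢ U := mem_of_superset Measure.support_mem_ae hsupp
  have h := integral_mono_ae
    ((integrable_of_continuousOn_compact (hK.prod hU) ae
      (hv.comp continuous_evalField).continuousOn).const_mul α)
    (integrable_of_continuousOn_compact (hK.prod hU) ae (hv.comp continuous_fst).continuousOn)
    (ae.mono fun z hz => h1 z.1 hz.1 z.2 hz.2)
  rw [integral_const_mul] at h
  have := hdyn v hv
  simp only [Function.comp_apply] at h
  linarith

theorem continuous_fderiv_evalField {v : (Fin n → ℝ) → ℝ} (hv : ContDiff ℝ 1 v) :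
    Continuous fun z : (Fin n → ℝ) × (Fin m → ℝ) => fderiv ℝ v z.1 (evalField f z.1 z.2) :=
  ((hv.continuous_fderiv one_ne_zero).comp continuous_fst).clm_apply continuous_evalField

theorem continuous_weak_duality {K : Set (Fin n → ℝ)} {U : Set (Fin m → ℝ)} (hK : IsCompact K)
    (hU : IsCompact U) {β p d : ℝ} (hp : p ∈ continuousPrimalValues f K U β)
    (hd : d ∈ continuousDualValues f K U β) : p ≤ d := by
  obtain ⟨μ, μ₀, μ₀', hμ, hsupp, hsplit, hdyn, rfl⟩ := hp
  obtain ⟨v, w, hv, hw, h1, h2, h3, rfl⟩ := hd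
  refine hsplit.measureReal_le hK hv.continuous.continuousOn hw h2 h3 ?_
  have ae : ∀ᵐ z ∂μ, z ∈ K ×ˢ U := mem_of_superset Measure.support_mem_ae hsupp
  have h := integral_mono_ae
    (integrable_of_continuousOn_compact (hK.prod hU) ae
      (continuous_fderiv_evalField hv).continuousOn)
    ((integrable_of_continuousOn_compact (hK.prod hU) ae
      (hv.continuous.comp continuous_fst).continuousOn).const_mul β)
    (ae.mono fun z hz => h1 z.1 hz.1 z.2 hz.2)
  rw [integral_const_mul] at h
  have := hdyn v hv
  simp only [Function.comp_apply] at h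
  linarith

/-- The dynamics constraint holds on polynomials and passes to continuous `v` by uniform
approximation. -/
theorem discretePrimal_of_functionals (hX : HasBallConstraint gX) (hU : HasBallConstraint gU)
    {α : ℝ} {L : MvPolynomial (Fin n ⊕ Fin m) ℝ →ₗ[ℝ] ℝ}
    {L₀ L₀' : MvPolynomial (Fin n) ℝ →ₗ[ℝ] ℝ}
    (hL : ∀ p ∈ quadraticModule (productConstraints gX gU), 0 ≤ L p)
    (hL₀ : ∀ p ∈ quadraticModule gX, 0 ≤ L₀ p) (hL₀' : ∀ p ∈ quadraticModule gX, 0 ≤ L₀' p)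
    (hA : ∀ v, L (discreteOp f α v) = L₀ v)
    (hsum : ∀ w, L₀ w + L₀' w = ∫ x in semialgSet gX, eval x w) :
    L₀ 1 ∈ discretePrimalValues f (semialgSet gX) (semialgSet gU) α := by
  obtain ⟨μ, μ₀, μ₀', hμ, hsupp, hsplit, hμL, hμ₀L, hval⟩ :=
    exists_measures_of_functionals hX hU hL hL₀ hL₀' hsum
  refine ⟨μ, μ₀, μ₀', hμ, hsupp, hsplit, fun v hv => ?_, hval⟩
  obtain ⟨hμ₀, -, hsupp₀, -, -⟩ := hsplit
  have hK : IsCompact (semialgSet gX) := hX.hasBallCover.boundsCoordinates.isCompact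
  have hKU : IsCompact (semialgSet gU) := hU.hasBallCover.boundsCoordinates.isCompact
  have ae : ∀ᵐ z ∂μ, z ∈ semialgSet gX ×ˢ semialgSet gU :=
    mem_of_superset Measure.support_mem_ae hsupp
  have ae₀ : ∀ᵐ x ∂μ₀, x ∈ semialgSet gX := mem_of_superset Measure.support_mem_ae hsupp₀
  set F : (Fin n → ℝ) × (Fin m → ℝ) → (Fin n → ℝ) := fun z => evalField f z.1 z.2 with hF
  have hFc : Continuous F := continuous_evalField
  -- `f` may leave `X`, so `v` has to be approximated on the image of `X × U` as well; the union is
  -- still compact.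
  set K' := semialgSet gX ∪ F '' (semialgSet gX ×ˢ semialgSet gU) with hK'
  have hK'c : IsCompact K' := hK.union ((hK.prod hKU).image hFc)
  have ae₁ : ∀ᵐ x ∂(μ.map Prod.fst), x ∈ K' := by
    refine (ae_map_iff (p := (· ∈ K')) measurable_fst.aemeasurable hK'c.measurableSet).2 ?_
    exact ae.mono fun z hz => .inl hz.1
  have ae₂ : ∀ᵐ x ∂(μ.map F), x ∈ K' := by
    refine (ae_map_iff (p := (· ∈ K')) hFc.measurable.aemeasurable hK'c.measurableSet).2 ?_
    exact ae.mono fun z hz => .inr ⟨z, hz, rfl⟩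
  have map₁ : ∀ w : (Fin n → ℝ) → ℝ, Continuous w →
      ∫ x, w x ∂(μ.map Prod.fst) = ∫ z, w z.1 ∂μ := fun w hw =>
    integral_map measurable_fst.aemeasurable hw.aestronglyMeasurable
  have map₂ : ∀ w : (Fin n → ℝ) → ℝ, Continuous w →
      ∫ x, w x ∂(μ.map F) = ∫ z, w (F z) ∂μ := fun w hw =>
    integral_map hFc.measurable.aemeasurable hw.aestronglyMeasurable
  have hpoly : ∀ p : MvPolynomial (Fin n) ℝ, ∫ x, eval x p ∂(μ.map Prod.fst) =
      ∫ x, eval x p ∂μ₀ + α * ∫ x, eval x p ∂(μ.map F) := by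
    intro p
    have h := hA p
    rw [hμL, hμ₀L] at h
    simp only [eval_discreteOp] at h
    rw [integral_sub, integral_const_mul] at h
    · rw [map₁ _ (continuous_eval p), map₂ _ (continuous_eval p), ← h]
      ring
    · exact integrable_of_continuousOn_compact (hK.prod hKU) ae
        ((continuous_eval p).comp continuous_fst).continuousOn
    · exact (integrable_of_continuousOn_compact (hK.prod hKU) ae
        ((continuous_eval p).comp hFc).continuousOn).const_mul α
  choose p hp using fun k : ℕ =>
    exists_polynomial_near hK'c hv.continuousOn (ε := 1 / ((k : ℝ) + 1)) (by positivity)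
  have t₁ := tendsto_integral_eval hK'c ae₁ hv.continuousOn hp
  have t₀ := tendsto_integral_eval hK'c (ae₀.mono fun x hx => .inl hx) hv.continuousOn hp
  have t₂ := tendsto_integral_eval hK'c ae₂ hv.continuousOn hp
  simp only [hpoly] at t₁
  have h := tendsto_nhds_unique t₁ (t₀.add (t₂.const_mul α))
  rwa [map₁ v hv, map₂ v hv] at h

/-- Uniform approximation of `v` does not control its gradient. Polynomials converging with their
derivatives pointwise on `X`, under uniform bounds, let dominated convergence handle all three
integrals. -/
theorem continuousPrimal_of_functionals (hX : HasBallConstraint gX) (hU : HasBallConstraint gU)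
    {β : ℝ} {L : MvPolynomial (Fin n ⊕ Fin m) ℝ →ₗ[ℝ] ℝ}
    {L₀ L₀' : MvPolynomial (Fin n) ℝ →ₗ[ℝ] ℝ}
    (hL : ∀ p ∈ quadraticModule (productConstraints gX gU), 0 ≤ L p)
    (hL₀ : ∀ p ∈ quadraticModule gX, 0 ≤ L₀ p) (hL₀' : ∀ p ∈ quadraticModule gX, 0 ≤ L₀' p)
    (hA : ∀ v, L (continuousOp f β v) = L₀ v)
    (hsum : ∀ w, L₀ w + L₀' w = ∫ x in semialgSet gX, eval x w) :
    L₀ 1 ∈ continuousPrimalValues f (semialgSet gX) (semialgSet gU) β := by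
  obtain ⟨μ, μ₀, μ₀', hμ, hsupp, hsplit, hμL, hμ₀L, hval⟩ :=
    exists_measures_of_functionals hX hU hL hL₀ hL₀' hsum
  refine ⟨μ, μ₀, μ₀', hμ, hsupp, hsplit, fun v hv => ?_, hval⟩
  obtain ⟨hμ₀, -, hsupp₀, -, -⟩ := hsplit
  have hK : IsCompact (semialgSet gX) := hX.hasBallCover.boundsCoordinates.isCompact
  have hKU : IsCompact (semialgSet gU) := hU.hasBallCover.boundsCoordinates.isCompact
  have ae : ∀ᵐ z ∂μ, z ∈ semialgSet gX ×ˢ semialgSet gU :=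
    mem_of_superset Measure.support_mem_ae hsupp
  have ae₀ : ∀ᵐ x ∂μ₀, x ∈ semialgSet gX := mem_of_superset Measure.support_mem_ae hsupp₀
  have hpoly : ∀ p : MvPolynomial (Fin n) ℝ, β * ∫ z, eval z.1 p ∂μ = ∫ x, eval x p ∂μ₀ +
      ∫ z, fderiv ℝ (fun x => eval x p) z.1 (evalField f z.1 z.2) ∂μ := by
    intro p
    have h := hA p
    rw [hμL, hμ₀L] at h
    simp only [eval_continuousOp] at h
    rw [integral_sub, integral_const_mul] at h
    · linarith
    · exact (integrable_of_continuousOn_compact (hK.prod hKU) ae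
        ((continuous_eval p).comp continuous_fst).continuousOn).const_mul β
    · exact integrable_of_continuousOn_compact (hK.prod hKU) ae
        (continuous_fderiv_evalField (contDiff_eval p)).continuousOn
  obtain ⟨p, B, hp⟩ := exists_polynomial_tendsto_fderiv hv hK
  have t₁ : Tendsto (fun k => ∫ z, eval z.1 (p k) ∂μ) atTop (𝓝 (∫ z, v z.1 ∂μ)) :=
    tendsto_integral_of_dominated_convergence (fun _ => B)
      (fun k => ((continuous_eval _).comp continuous_fst).aestronglyMeasurable)
      (integrable_const _) (fun k => ae.mono fun z hz => ((hp z.1 hz.1).2.2 k).1)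
      (ae.mono fun z hz => (hp z.1 hz.1).1)
  have t₀ : Tendsto (fun k => ∫ x, eval x (p k) ∂μ₀) atTop (𝓝 (∫ x, v x ∂μ₀)) :=
    tendsto_integral_of_dominated_convergence (fun _ => B)
      (fun k => (continuous_eval _).aestronglyMeasurable)
      (integrable_const _) (fun k => ae₀.mono fun x hx => ((hp x hx).2.2 k).1)
      (ae₀.mono fun x hx => (hp x hx).1)
  have t₂ : Tendsto
      (fun k => ∫ z, fderiv ℝ (fun x => eval x (p k)) z.1 (evalField f z.1 z.2) ∂μ) atTop
      (𝓝 (∫ z, fderiv ℝ v z.1 (evalField f z.1 z.2) ∂μ)) := by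
    refine tendsto_integral_of_dominated_convergence (fun z => B * ‖evalField f z.1 z.2‖)
      (fun k => (continuous_fderiv_evalField (contDiff_eval (p k))).aestronglyMeasurable)
      ((integrable_of_continuousOn_compact (hK.prod hKU) ae
        continuous_evalField.norm.continuousOn).const_mul B)
      (fun k => ae.mono fun z hz => ?_) (ae.mono fun z hz => ?_)
    · exact ContinuousLinearMap.le_of_opNorm_le _ ((hp z.1 hz.1).2.2 k).2 _
    · exact ((ContinuousLinearMap.apply ℝ ℝ (evalField f z.1 z.2)).continuous.tendsto _).comp
        (hp z.1 hz.1).2.1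
  have t₃ := t₁.const_mul β
  simp only [hpoly] at t₃
  exact tendsto_nhds_unique t₃ (t₀.add t₂)

end Programs

end MCI

end

theorem mainTheorem5 {n m nX nU : ℕ} (f : Fin n → MvPolynomial (Fin n ⊕ Fin m) ℝ)
    (gX : Fin nX → MvPolynomial (Fin n) ℝ) (gU : Fin nU → MvPolynomial (Fin m) ℝ)
    (hX : MCI.HasBallConstraint gX) (hU : MCI.HasBallConstraint gU)
    (r : ℕ → ℕ) (hr : Monotone r) (hkr : ∀ k, k ≤ r k) :
    (∀ α : ℝ, 0 < α → α < 1 →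
      MCI.ValuesConverge
        (MCI.discreteDualValues f (MCI.semialgSet gX) (MCI.semialgSet gU) α)
        (fun k => MCI.dualApproximationValues (MCI.discreteOp f α) gX gU k (r k))
        (MCI.discretePrimalValues f (MCI.semialgSet gX) (MCI.semialgSet gU) α)
        (fun k => MCI.primalRelaxationValues (MCI.discreteOp f α) gX gU k (r k))) ∧
    (∀ β : ℝ, 0 < β →
      MCI.ValuesConverge
        (MCI.continuousDualValues f (MCI.semialgSet gX) (MCI.semialgSet gU) β)
        (fun k => MCI.dualApproximationValues (MCI.continuousOp f β) gX gU k (r k))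
        (MCI.continuousPrimalValues f (MCI.semialgSet gX) (MCI.semialgSet gU) β)
        (fun k => MCI.primalRelaxationValues (MCI.continuousOp f β) gX gU k (r k))) := by
  have hK := hX.hasBallCover.boundsCoordinates.isCompact
  have hKU := hU.hasBallCover.boundsCoordinates.isCompact
  refine ⟨fun α _ hα1 => ?_, fun β hβ => ?_⟩
  · exact MCI.valuesConverge_of_polynomial_feasible (A := MCI.discreteOpLinear f α) hX hU hr hkr
      -- On constants the discrete operator is multiplication by `1 - α`; the continuous one, whose
      -- gradient term vanishes, multiplies by `β`.
      (δ := 1 - α) (by linarith)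
      (by change MCI.discreteOp f α 1 = _; simp [MCI.discreteOp])
      (fun v w h1 h2 h3 => MCI.discreteDual_of_polynomials h1 h2 h3)
      (fun p hp d hd => MCI.discrete_weak_duality hK hKU hp hd)
      (fun L L₀ L₀' hL hL₀ hL₀' hA hsum =>
        MCI.discretePrimal_of_functionals hX hU hL hL₀ hL₀' hA hsum)
  · exact MCI.valuesConverge_of_polynomial_feasible (A := MCI.continuousOpLinear f β) hX hU hr hkr
      hβ (by change MCI.continuousOp f β 1 = _; simp [MCI.continuousOp])
      (fun v w h1 h2 h3 => MCI.continuousDual_of_polynomials h1 h2 h3)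
      (fun p hp d hd => MCI.continuous_weak_duality hK hKU hp hd)
      (fun L L₀ L₀' hL hL₀ hL₀' hA hsum =>
        MCI.continuousPrimal_of_functionals hX hU hL hL₀ hL₀' hA hsum)
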